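/- Let $M$ be a smooth 3-dimensional (Hausdorff) manifold without boundary. Let $(\varphi,\xi,\eta,g)$ be a smooth para-Sasakian structure on $M$. That is, $\varphi$ is a $(1,1)$-tensor field, $\xi$ a vector field and $\eta$ a 1-form with $$\eta(\xi)=1,\qquad \varphi^2=\mathrm{Id}-\eta\otimes\xi,$$ such that the $\pm1$-eigendistributions of $\varphi$ in $\ker\eta$ have equal dimension; $g$ is a semi-Riemannian metric with $$g(\varphi X,\varphi Y)=-g(X,Y)+\eta(X)\eta(Y),\qquad d\eta(X,Y)=\Phi(X,Y):=g(X,\varphi Y);$$ and the structure is normal, that is, $[\varphi,\varphi]-2\,d\eta\otimes\xi=0$, where $$[\varphi,\varphi](X,Y)=\varphi^2[X,Y]+[\varphi X,\varphi Y]-\varphi[\varphi X,Y]-\varphi[X,\varphi Y].$$ Here $d\eta(X,Y)=\tfrac12\big(X(\eta(Y))-Y(\eta(X))-\eta([X,Y])\big)$. Let $\nabla$ be the Levi-Civita connection of $g$, and put $R(X,Y)Z=\nabla_X\nabla_YZ-\nabla_Y\nabla_XZ-\nabla_{[X,Y]}Z$ and $S(Y,Z)=\operatorname{tr}(X\mapsto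 R(X,Y)Z)$. Let the Ricci operator $Q$ be given by $g(QX,Y)=S(X,Y)$, and let $r=\operatorname{tr}Q$ be the scalar curvature. Suppose that $g$ is a Yamabe soliton: there are a smooth vector field $V$ and a real number $\lambda$ with $$\mathcal L_Vg=(\lambda-r)g .$$ Then the following hold. 1. The scalar curvature $r$ is constant, and $\lambda=r$. 2. $V$ is a Killing vector field: $\mathcal L_Vg=0$. 3. Either $r=-6$, or $V$ is an infinitesimal automorphism of the paracontact metric structure: $\mathcal L_V\eta=0$, $\mathcal L_V\xi=0$, $\mathcal L_V\Phi=0$ and $\mathcal L_Vg=0$. 4. If $r=-6$, then $M$ is Einstein ($S$ is a constant multiple of $g$) and has constant curvature $-1$: $R(X,Y)Z=-\big(g(Y,Z)X-g(X,Z)Y\big)$. -/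

import Mathlib

open scoped Manifold ContDiff Bundle

noncomputable section

/-- The trace of an endomorphism of a finite-dimensional real vector space, as the sum of the
diagonal coefficients in a basis. It is written for a bare function so that it can be applied to
maps whose linearity is a theorem; for a linear map it is the usual trace. -/
def diagSum {W : Type*} [AddCommGroup W] [Module ℝ W] [FiniteDimensional ℝ W] (f : W → W) : ℝ :=
  ∑ i, (Module.finBasis ℝ W).repr (f (Module.finBasis ℝ W i)) i

theorem diagSum_linear {W : Type*} [AddCommGroup W] [Module ℝ W] [FiniteDimensional ℝ W]
    (f : W →ₗ[ℝ] W) : diagSum f = LinearMap.trace ℝ W f := by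
  rw [LinearMap.trace_eq_matrix_trace ℝ (Module.finBasis ℝ W), Matrix.trace]
  simp [diagSum, LinearMap.toMatrix_apply]

section Tensors

variable {n : ℕ} {M : Type*} [TopologicalSpace M] [ChartedSpace (EuclideanSpace ℝ (Fin n)) M]

instance tangentSpaceFiniteDimensional (x : M) : FiniteDimensional ℝ (TangentSpace (𝓡 n) x) :=
  inferInstanceAs (FiniteDimensional ℝ (EuclideanSpace ℝ (Fin n)))

/-- The vector field `X` is differentiable at the point `x`. -/
abbrev DiffFieldAt [IsManifold (𝓡 n) ∞ M] (X : ∀ x : M, TangentSpace (𝓡 n) x) (x : M) : Prop :=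
  MDifferentiableAt (𝓡 n) ((𝓡 n).prod 𝓘(ℝ, EuclideanSpace ℝ (Fin n)))
    (fun y ↦ (Bundle.TotalSpace.mk' (EuclideanSpace ℝ (Fin n)) y (X y) : TangentBundle (𝓡 n) M)) x

/-- The vector field `X` is smooth at the point `x`. -/
abbrev SmoothFieldAt [IsManifold (𝓡 n) ∞ M] (X : ∀ x : M, TangentSpace (𝓡 n) x) (x : M) : Prop :=
  ContMDiffAt (𝓡 n) ((𝓡 n).prod 𝓘(ℝ, EuclideanSpace ℝ (Fin n))) ∞
    (fun y ↦ (Bundle.TotalSpace.mk' (EuclideanSpace ℝ (Fin n)) y (X y) : TangentBundle (𝓡 n) M)) x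

/-- The derivative `X f` of a function `f` along a vector field `X`, at the point `x`. -/
def dirDeriv (X : ∀ x : M, TangentSpace (𝓡 n) x) (f : M → ℝ) (x : M) : ℝ :=
  mvfderiv (𝓡 n) f x (X x)

/-- The Lie derivative of a vector field: `L_V X = [V, X]`. -/
def lieDerivField (V X : ∀ x : M, TangentSpace (𝓡 n) x) (x : M) : TangentSpace (𝓡 n) x :=
  VectorField.mlieBracket (𝓡 n) V X x

/-- The Lie derivative of a one-form:
`(L_V α)(X) = V (α X) - α [V, X]`. -/
def lieDerivForm (V : ∀ x : M, TangentSpace (𝓡 n) x)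
    (α : ∀ x : M, TangentSpace (𝓡 n) x →L[ℝ] ℝ)
    (X : ∀ x : M, TangentSpace (𝓡 n) x) (x : M) : ℝ :=
  dirDeriv V (fun y ↦ α y (X y)) x - α x (VectorField.mlieBracket (𝓡 n) V X x)

/-- The Lie derivative of a `(0,2)`-tensor field:
`(L_V T)(X, Y) = V (T(X, Y)) - T([V, X], Y) - T(X, [V, Y])`. -/
def lieDerivTensor (V : ∀ x : M, TangentSpace (𝓡 n) x)
    (T : ∀ x : M, TangentSpace (𝓡 n) x → TangentSpace (𝓡 n) x → ℝ)
    (X Y : ∀ x : M, TangentSpace (𝓡 n) x) (x : M) : ℝ :=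
  dirDeriv V (fun y ↦ T y (X y) (Y y)) x
    - T x (VectorField.mlieBracket (𝓡 n) V X x) (Y x)
    - T x (X x) (VectorField.mlieBracket (𝓡 n) V Y x)

/-- The exterior derivative of a one-form, with the normalisation
`dα(X, Y) = (X (α Y) - Y (α X) - α [X, Y]) / 2`. -/
def extDerivForm (α : ∀ x : M, TangentSpace (𝓡 n) x →L[ℝ] ℝ)
    (X Y : ∀ x : M, TangentSpace (𝓡 n) x) (x : M) : ℝ :=
  (dirDeriv X (fun y ↦ α y (Y y)) x - dirDeriv Y (fun y ↦ α y (X y)) x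
    - α x (VectorField.mlieBracket (𝓡 n) X Y x)) / 2

end Tensors

section Metric

/-- A smooth semi-Riemannian metric on an `n`-dimensional smooth manifold: a smooth field of
symmetric nondegenerate bilinear forms on the tangent spaces, of arbitrary signature. -/
structure SemiRiemannianMetric (n : ℕ) (M : Type*) [TopologicalSpace M]
    [ChartedSpace (EuclideanSpace ℝ (Fin n)) M] [IsManifold (𝓡 n) ∞ M] where
  /-- the bilinear form on each tangent space -/
  inner : ∀ x : M, TangentSpace (𝓡 n) x →L[ℝ] TangentSpace (𝓡 n) x →L[ℝ] ℝ
  symm : ∀ (x : M) (u v : TangentSpace (𝓡 n) x), inner x u v = inner x v u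
  nondegenerate : ∀ (x : M) (u : TangentSpace (𝓡 n) x), (∀ v, inner x u v = 0) → u = 0
  contMDiff : ContMDiff (𝓡 n)
    ((𝓡 n).prod 𝓘(ℝ, EuclideanSpace ℝ (Fin n) →L[ℝ] EuclideanSpace ℝ (Fin n) →L[ℝ] ℝ)) ∞
    (fun x ↦ Bundle.TotalSpace.mk'
      (EuclideanSpace ℝ (Fin n) →L[ℝ] EuclideanSpace ℝ (Fin n) →L[ℝ] ℝ)
      (E := fun x : M ↦ TangentSpace (𝓡 n) x →L[ℝ] TangentSpace (𝓡 n) x →L[ℝ] ℝ) x (inner x))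

namespace SemiRiemannianMetric

variable {n : ℕ} {M : Type*} [TopologicalSpace M] [ChartedSpace (EuclideanSpace ℝ (Fin n)) M]
  [IsManifold (𝓡 n) ∞ M] (g : SemiRiemannianMetric n M)

open Classical in
/-- The tangent vector `w` at `x` with `g(w, v) = α v` for all `v`. It exists and is unique for
every linear functional `α`. -/
def sharp (x : M) (α : TangentSpace (𝓡 n) x → ℝ) : TangentSpace (𝓡 n) x :=
  if h : ∃ w, ∀ v, g.inner x w v = α v then h.choose else 0

theorem inner_sharp (x : M) (α : TangentSpace (𝓡 n) x →ₗ[ℝ] ℝ) (v : TangentSpace (𝓡 n) x) :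
    g.inner x (g.sharp x α) v = α v := by
  have h : ∃ w, ∀ v, g.inner x w v = α v := by
    let L : TangentSpace (𝓡 n) x →ₗ[ℝ] Module.Dual ℝ (TangentSpace (𝓡 n) x) :=
      { toFun := fun w ↦ (g.inner x w).toLinearMap
        map_add' := fun a b ↦ by ext; simp
        map_smul' := fun c a ↦ by ext; simp }
    have hi : Function.Injective L := by
      rw [← LinearMap.ker_eq_bot, LinearMap.ker_eq_bot']
      intro w hw
      exact g.nondegenerate x w fun v ↦ congrArg (fun f ↦ f v) hw
    obtain ⟨w, hw⟩ := (LinearMap.injective_iff_surjective_of_finrank_eq_finrank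
      (Subspace.dual_finrank_eq).symm).1 hi α
    exact ⟨w, fun v ↦ congrArg (fun f ↦ f v) hw⟩
  unfold sharp
  rw [dif_pos h]
  exact h.choose_spec v

/-- The right-hand side of the Koszul formula for `2 g(∇_X Y, Z)`. -/
def koszul (X Y Z : ∀ x : M, TangentSpace (𝓡 n) x) (x : M) : ℝ :=
  dirDeriv X (fun y ↦ g.inner y (Y y) (Z y)) x
    + dirDeriv Y (fun y ↦ g.inner y (X y) (Z y)) x
    - dirDeriv Z (fun y ↦ g.inner y (X y) (Y y)) x
    + g.inner x (VectorField.mlieBracket (𝓡 n) X Y x) (Z x)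
    - g.inner x (VectorField.mlieBracket (𝓡 n) X Z x) (Y x)
    - g.inner x (VectorField.mlieBracket (𝓡 n) Y Z x) (X x)

/-- The Levi-Civita connection: `∇_X Y` at `x` is the vector whose product with each tangent
vector `v` is given by the Koszul formula, with `v` extended to a vector field that is smooth
near `x` (the formula is tensorial in the third field, so the extension does not matter). -/
def leviCivita (X Y : ∀ x : M, TangentSpace (𝓡 n) x) (x : M) : TangentSpace (𝓡 n) x :=
  g.sharp x fun v ↦ g.koszul X Y (FiberBundle.extend (EuclideanSpace ℝ (Fin n)) v) x / 2

theorem mdifferentiableAt_inner {X Y : ∀ x : M, TangentSpace (𝓡 n) x} {x : M}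
    (hX : DiffFieldAt X x) (hY : DiffFieldAt Y x) :
    MDifferentiableAt (𝓡 n) 𝓘(ℝ, ℝ) (fun y ↦ g.inner y (X y) (Y y)) x := by
  have h := MDifferentiableWithinAt.clm_bundle_apply₂ (F₁ := EuclideanSpace ℝ (Fin n))
    (F₂ := EuclideanSpace ℝ (Fin n)) (F₃ := ℝ) (E₃ := Bundle.Trivial M ℝ)
    ((g.contMDiff x).mdifferentiableAt (by simp)).mdifferentiableWithinAt
    hX.mdifferentiableWithinAt hY.mdifferentiableWithinAt (s := Set.univ)
  simp only [mdifferentiableWithinAt_totalSpace] at h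
  exact mdifferentiableWithinAt_univ.1 h.2

theorem tensorialAt_koszul {X Y : ∀ x : M, TangentSpace (𝓡 n) x} {x : M}
    (hX : DiffFieldAt X x) (hY : DiffFieldAt Y x) :
    TensorialAt (𝓡 n) (EuclideanSpace ℝ (Fin n)) (fun Z ↦ g.koszul X Y Z x) x where
  smul {f Z} hf hZ := by
    have h1 : (fun y ↦ g.inner y (Y y) ((f • Z) y)) = f * fun y ↦ g.inner y (Y y) (Z y) := by
      ext y; simp
    have h2 : (fun y ↦ g.inner y (X y) ((f • Z) y)) = f * fun y ↦ g.inner y (X y) (Z y) := by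
      ext y; simp
    simp only [koszul, dirDeriv, h1, h2, mvfderiv_mul hf (g.mdifferentiableAt_inner hY hZ),
      mvfderiv_mul hf (g.mdifferentiableAt_inner hX hZ),
      VectorField.mlieBracket_smul_right hf hZ]
    simp [g.symm x (Z x)]
    ring
  add {Z Z'} hZ hZ' := by
    have h1 : (fun y ↦ g.inner y (Y y) ((Z + Z') y))
        = (fun y ↦ g.inner y (Y y) (Z y)) + fun y ↦ g.inner y (Y y) (Z' y) := by
      ext y; simp
    have h2 : (fun y ↦ g.inner y (X y) ((Z + Z') y))
        = (fun y ↦ g.inner y (X y) (Z y)) + fun y ↦ g.inner y (X y) (Z' y) := by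
      ext y; simp
    simp only [koszul, dirDeriv, h1, h2,
      mvfderiv_add (g.mdifferentiableAt_inner hY hZ) (g.mdifferentiableAt_inner hY hZ'),
      mvfderiv_add (g.mdifferentiableAt_inner hX hZ) (g.mdifferentiableAt_inner hX hZ'),
      VectorField.mlieBracket_add_right hZ hZ']
    simp
    ring

/-- The Koszul formula. -/
theorem two_mul_inner_leviCivita {X Y Z : ∀ x : M, TangentSpace (𝓡 n) x} {x : M}
    (hX : DiffFieldAt X x) (hY : DiffFieldAt Y x) (hZ : DiffFieldAt Z x) :
    2 * g.inner x (g.leviCivita X Y x) (Z x) = g.koszul X Y Z x := by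
  have hT := g.tensorialAt_koszul hX hY
  have h := g.inner_sharp x ((2 : ℝ)⁻¹ • (TensorialAt.mkHom _ x hT).toLinearMap) (Z x)
  have e : ⇑((2 : ℝ)⁻¹ • (TensorialAt.mkHom _ x hT).toLinearMap)
      = fun v ↦ g.koszul X Y (FiberBundle.extend (EuclideanSpace ℝ (Fin n)) v) x / 2 := by
    ext v
    simp [TensorialAt.mkHom_apply_eq_extend]
    ring
  rw [e] at h
  have h3 := TensorialAt.mkHom_apply hT hZ
  rw [TensorialAt.mkHom_apply_eq_extend] at h3
  unfold leviCivita
  rw [h]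
  simp only [h3]
  ring

/-- The curvature `R(X, Y) Z = ∇_X ∇_Y Z - ∇_Y ∇_X Z - ∇_[X, Y] Z`. -/
def curvature (X Y Z : ∀ x : M, TangentSpace (𝓡 n) x) (x : M) : TangentSpace (𝓡 n) x :=
  g.leviCivita X (g.leviCivita Y Z) x - g.leviCivita Y (g.leviCivita X Z) x
    - g.leviCivita (VectorField.mlieBracket (𝓡 n) X Y) Z x

/-- The curvature tensor on tangent vectors at `x`, through extensions of the vectors to fields
that are smooth near `x` (the curvature is tensorial, so the extensions do not matter). -/
def curvatureAt (x : M) (u v w : TangentSpace (𝓡 n) x) : TangentSpace (𝓡 n) x :=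
  g.curvature (FiberBundle.extend (EuclideanSpace ℝ (Fin n)) u)
    (FiberBundle.extend (EuclideanSpace ℝ (Fin n)) v)
    (FiberBundle.extend (EuclideanSpace ℝ (Fin n)) w) x

/-- The Ricci tensor `S(v, w) = tr (u ↦ R(u, v) w)`. -/
def ricci (x : M) (v w : TangentSpace (𝓡 n) x) : ℝ :=
  diagSum fun u ↦ g.curvatureAt x u v w

/-- The Ricci operator `Q`, with `g(Q v, w) = S(v, w)`. -/
def ricciOperator (x : M) (v : TangentSpace (𝓡 n) x) : TangentSpace (𝓡 n) x :=
  g.sharp x fun w ↦ g.ricci x v w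

/-- The scalar curvature `r = tr Q`. -/
def scalarCurvature (x : M) : ℝ :=
  diagSum (g.ricciOperator x)

/-- The metric is Einstein: the Ricci tensor is a constant multiple of it. -/
def IsEinstein : Prop :=
  ∃ c : ℝ, ∀ (x : M) (u v : TangentSpace (𝓡 n) x), g.ricci x u v = c * g.inner x u v

/-- The metric has constant curvature `c`: `R(u, v) w = c (g(v, w) u - g(u, w) v)`, for the
curvature tensor with the sign fixed above. -/
def HasConstantCurvature (c : ℝ) : Prop :=
  ∀ (x : M) (u v w : TangentSpace (𝓡 n) x),
    g.curvatureAt x u v w = c • (g.inner x v w • u - g.inner x u w • v)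

/-- The vector field `V` is Killing: `L_V g = 0`. -/
def IsKilling (V : ∀ x : M, TangentSpace (𝓡 n) x) : Prop :=
  ∀ (x : M) (X Y : ∀ x : M, TangentSpace (𝓡 n) x), SmoothFieldAt X x → SmoothFieldAt Y x →
    lieDerivTensor V (fun y u v ↦ g.inner y u v) X Y x = 0

/-- The metric is a Yamabe soliton with smooth soliton vector field `V` and constant `lam`:
`L_V g = (lam - r) g`. -/
def IsYamabeSoliton (V : ∀ x : M, TangentSpace (𝓡 n) x) (lam : ℝ) : Prop :=
  (∀ x, SmoothFieldAt V x) ∧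
  ∀ (x : M) (X Y : ∀ x : M, TangentSpace (𝓡 n) x), SmoothFieldAt X x → SmoothFieldAt Y x →
    lieDerivTensor V (fun y u v ↦ g.inner y u v) X Y x = (lam - g.scalarCurvature x) * g.inner x (X x) (Y x)

end SemiRiemannianMetric

end Metric

section Paracontact

/-- A smooth almost paracontact structure `(φ, ξ, η)`: a `(1,1)`-tensor field, a vector field and
a one-form with `η(ξ) = 1` and `φ² = id - η ⊗ ξ`, such that the eigendistributions of `φ` for
the eigenvalues `1` and `-1` in `ker η` have equal dimension. -/
structure AlmostParacontactStructure (n : ℕ) (M : Type*) [TopologicalSpace M]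
    [ChartedSpace (EuclideanSpace ℝ (Fin n)) M] [IsManifold (𝓡 n) ∞ M] where
  φ : ∀ x : M, TangentSpace (𝓡 n) x →L[ℝ] TangentSpace (𝓡 n) x
  ξ : ∀ x : M, TangentSpace (𝓡 n) x
  η : ∀ x : M, TangentSpace (𝓡 n) x →L[ℝ] ℝ
  contMDiff_φ : ContMDiff (𝓡 n)
    ((𝓡 n).prod 𝓘(ℝ, EuclideanSpace ℝ (Fin n) →L[ℝ] EuclideanSpace ℝ (Fin n))) ∞
    (fun x ↦ Bundle.TotalSpace.mk' (EuclideanSpace ℝ (Fin n) →L[ℝ] EuclideanSpace ℝ (Fin n))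
      (E := fun x : M ↦ TangentSpace (𝓡 n) x →L[ℝ] TangentSpace (𝓡 n) x) x (φ x))
  contMDiff_ξ : ∀ x, SmoothFieldAt ξ x
  contMDiff_η : ContMDiff (𝓡 n) ((𝓡 n).prod 𝓘(ℝ, EuclideanSpace ℝ (Fin n) →L[ℝ] ℝ)) ∞
    (fun x ↦ Bundle.TotalSpace.mk' (EuclideanSpace ℝ (Fin n) →L[ℝ] ℝ)
      (E := fun x : M ↦ TangentSpace (𝓡 n) x →L[ℝ] ℝ) x (η x))
  η_ξ : ∀ x, η x (ξ x) = 1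
  φ_sq : ∀ (x : M) (v : TangentSpace (𝓡 n) x), φ x (φ x v) = v - η x v • ξ x
  finrank_eigen : ∀ x : M,
    Module.finrank ℝ ↥(Module.End.eigenspace (φ x).toLinearMap (1 : ℝ)
        ⊓ LinearMap.ker (η x).toLinearMap)
      = Module.finrank ℝ ↥(Module.End.eigenspace (φ x).toLinearMap (-1 : ℝ)
        ⊓ LinearMap.ker (η x).toLinearMap)

namespace AlmostParacontactStructure

variable {n : ℕ} {M : Type*} [TopologicalSpace M] [ChartedSpace (EuclideanSpace ℝ (Fin n)) M]
  [IsManifold (𝓡 n) ∞ M] (P : AlmostParacontactStructure n M) (g : SemiRiemannianMetric n M)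

/-- The Nijenhuis torsion
`[φ, φ](X, Y) = φ² [X, Y] + [φ X, φ Y] - φ [φ X, Y] - φ [X, φ Y]`. -/
def nijenhuis (X Y : ∀ x : M, TangentSpace (𝓡 n) x) (x : M) : TangentSpace (𝓡 n) x :=
  P.φ x (P.φ x (VectorField.mlieBracket (𝓡 n) X Y x))
    + VectorField.mlieBracket (𝓡 n) (fun y ↦ P.φ y (X y)) (fun y ↦ P.φ y (Y y)) x
    - P.φ x (VectorField.mlieBracket (𝓡 n) (fun y ↦ P.φ y (X y)) Y x)
    - P.φ x (VectorField.mlieBracket (𝓡 n) X (fun y ↦ P.φ y (Y y)) x)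

/-- The structure is normal: `[φ, φ] - 2 dη ⊗ ξ = 0`. -/
def IsNormal : Prop :=
  ∀ (x : M) (X Y : ∀ x : M, TangentSpace (𝓡 n) x), SmoothFieldAt X x → SmoothFieldAt Y x →
    P.nijenhuis X Y x - (2 * extDerivForm P.η X Y x) • P.ξ x = 0

/-- The metric is compatible: `g(φ X, φ Y) = - g(X, Y) + η(X) η(Y)`, so that `(φ, ξ, η, g)` is an
almost paracontact metric structure. -/
def IsCompatible : Prop :=
  ∀ (x : M) (u v : TangentSpace (𝓡 n) x),
    g.inner x (P.φ x u) (P.φ x v) = -g.inner x u v + P.η x u * P.η x v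

/-- The fundamental form `Φ(X, Y) = g(X, φ Y)`. -/
def fundamentalForm (x : M) (u v : TangentSpace (𝓡 n) x) : ℝ :=
  g.inner x u (P.φ x v)

/-- `(φ, ξ, η, g)` is a paracontact metric structure: an almost paracontact metric structure with
`dη(X, Y) = g(X, φ Y)`. -/
def IsParacontactMetric : Prop :=
  P.IsCompatible g ∧
  ∀ (x : M) (X Y : ∀ x : M, TangentSpace (𝓡 n) x), SmoothFieldAt X x → SmoothFieldAt Y x →
    extDerivForm P.η X Y x = P.fundamentalForm g x (X x) (Y x)

/-- `(φ, ξ, η, g)` is para-Sasakian: a normal paracontact metric structure. -/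
def IsParaSasakian : Prop :=
  P.IsParacontactMetric g ∧ P.IsNormal

/-- `V` is an infinitesimal automorphism of the almost paracontact metric structure
`(φ, ξ, η, g)`: `L_V η = 0`, `L_V ξ = 0`, `L_V Φ = 0` and `L_V g = 0`. -/
def IsInfinitesimalAutomorphism (V : ∀ x : M, TangentSpace (𝓡 n) x) : Prop :=
  (∀ (x : M) (X : ∀ x : M, TangentSpace (𝓡 n) x), SmoothFieldAt X x →
    lieDerivForm V P.η X x = 0) ∧
  (∀ x : M, lieDerivField V P.ξ x = 0) ∧
  (∀ (x : M) (X Y : ∀ x : M, TangentSpace (𝓡 n) x), SmoothFieldAt X x → SmoothFieldAt Y x →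
    lieDerivTensor V (P.fundamentalForm g) X Y x = 0) ∧
  (∀ (x : M) (X Y : ∀ x : M, TangentSpace (𝓡 n) x), SmoothFieldAt X x → SmoothFieldAt Y x →
    lieDerivTensor V (fun y u v ↦ g.inner y u v) X Y x = 0)

end AlmostParacontactStructure

end Paracontact

end

/-!
Near every point the eigenspaces of `φ` in `ker η` are spanned by null fields `u` and `v` with
`φ u = u`, `φ v = -v` and `g(u, v) = 1`. The para-Sasakian conditions amount to
`[ξ, u] = a u`, `[ξ, v] = -a v` and `[u, v] = 2 ξ + p u + q v` for functions `a`, `p`, `q`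
(`NullFrame.mlieBracket_ξ_u`, `NullFrame.mlieBracket_ξ_v`, `NullFrame.mlieBracket_u_v`). The whole
curvature tensor is then governed by the single function `K = u p - v q - 2 p q + 2 a`
(`NullFrame.curvatureAt_eq`): the Ricci tensor is `(2 - K) g + (K - 4) η ⊗ η`, the scalar curvature
is `r = 2 - 2 K`, and the Jacobi identity gives `ξ K = 0`.

Write a soliton field as `V = α u + β v + γ ξ` and put `σ = (lam - r) / 2`, so that `L_V g = 2 σ g`
and `ξ σ = 0`. The soliton equation is a first-order system for `α`, `β`, `γ`
(`ConformalComponents`), and its compatibility conditions under the commutators of the frame give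
* `(K - 4) (2 α - v γ) = -v σ` and `(K - 4) (2 β + u γ) = -u σ`,
* `u v σ = q v σ + 2 σ`,
* `(K - 2) v σ = 0`, and with the previous line `(K - 2)² σ = 0`.

This part is pure algebra with derivations of a commutative ring, and it is carried out there; the
ring is that of the smooth functions on the domain of the frame. If `σ` were nonzero at a point,
then `K = 2` near that point, so `σ` would be constant there, and `u v σ = q v σ + 2 σ` would force
`σ = 0`. Hence `lam = r`, and `V` is Killing. If `r = -6`, then `K = 4`, and the curvature formula is that
of constant curvature `-1`. If `r ≠ -6`, then `2 α = v γ` and `2 β = -u γ`, which says that `V`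
commutes with `ξ`. A Killing field that commutes with `ξ` preserves `η`, hence the two null lines of
`ker η`, hence `φ`.
-/

open scoped Topology

/-! ### Derivations with the commutators of a null frame -/

section FrameAlgebra

variable {A : Type*} [CommRing A] [Algebra ℝ A] (u v ξ : Derivation ℝ A A)

/-- The commutators of three derivations `u`, `v`, `ξ` of a commutative ring that are satisfied by
a null frame of a three-dimensional para-Sasakian manifold: `[ξ, u] = a u`, `[ξ, v] = -a v` and
`[u, v] = 2 ξ + p u + q v`. The last two fields are the components of the Jacobi identity. -/
structure FrameBrackets (a p q : A) : Prop where
  comm_ξ_u : ∀ f, ξ (u f) - u (ξ f) = a * u f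
  comm_ξ_v : ∀ f, ξ (v f) - v (ξ f) = -(a * v f)
  comm_u_v : ∀ f, u (v f) - v (u f) = 2 * ξ f + p * u f + q * v f
  jacobi_u : ξ p + p * a = -v a
  jacobi_v : ξ q - q * a = -u a

/-- The equation `L_V g = 2 σ g` for `V = α u + β v + γ ξ`, written out on the pairs from a frame
`u`, `v`, `ξ` with `FrameBrackets` whose only nonzero products are `g(u, v) = g(ξ, ξ) = 1`. -/
structure ConformalComponents (a p q α β γ σ : A) : Prop where
  ξ_γ : ξ γ = σ
  u_β : u β = -(q * β)
  v_α : v α = p * α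
  div : u α + v β = q * α - p * β + 2 * σ
  ξ_β : ξ β = a * β - 2 * β - u γ
  ξ_α : ξ α = 2 * α - a * α - v γ

theorem Derivation.map_ofNat (D : Derivation ℝ A A) (n : ℕ) [n.AtLeastTwo] :
    D (ofNat(n) : A) = 0 := D.map_natCast n

/-- The one function that determines the curvature of a three-dimensional para-Sasakian metric: in
a null frame, `R(u, v) u = (3 - K) u` for `K = u p - v q - 2 p q + 2 a`. -/
def frameCurvature (a p q : A) : A := u p - v q - 2 * p * q + 2 * a

variable {u v ξ} {a p q : A}

/-- `[ξ, u]` applied to `p`, `[ξ, v]` applied to `q` and `[u, v]` applied to `a`, together with the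
derivatives of the Jacobi identity, show that the curvature function is constant along `ξ`. -/
theorem FrameBrackets.ξ_frameCurvature (h : FrameBrackets u v ξ a p q) :
    ξ (frameCurvature u v a p q) = 0 := by
  have h1 := h.comm_ξ_u p
  have h2 := h.comm_ξ_v q
  have h3 := congrArg u h.jacobi_u
  have h4 := congrArg v h.jacobi_v
  have h5 := h.comm_u_v a
  simp only [frameCurvature, map_add, map_sub, map_neg, Derivation.leibniz, smul_eq_mul,
    Derivation.map_ofNat] at *
  linear_combination h1 - h2 + h3 - h4 - h5 - 2 * q * h.jacobi_u - 2 * p * h.jacobi_v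

variable {α β γ σ : A}

/-- Compatibility of the equations for `u β` and `ξ β`, through `[ξ, u] β = a u β`. -/
theorem ConformalComponents.u_u_γ (h : FrameBrackets u v ξ a p q)
    (c : ConformalComponents u v ξ a p q α β γ σ) : u (u γ) = -(q * u γ) := by
  have h1 := h.comm_ξ_u β
  have h2 := congrArg u c.ξ_β
  have h3 := congrArg ξ c.u_β
  simp only [map_sub, map_neg, Derivation.leibniz, smul_eq_mul, Derivation.map_ofNat] at *
  linear_combination h1 - h3 + h2 + q * c.ξ_β + (2 * a - 2)* c.u_β + β * h.jacobi_v

/-- Compatibility of the equations for `v α` and `ξ α`, through `[ξ, v] α = -a v α`. -/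
theorem ConformalComponents.v_v_γ (h : FrameBrackets u v ξ a p q)
    (c : ConformalComponents u v ξ a p q α β γ σ) : v (v γ) = p * v γ := by
  have h1 := h.comm_ξ_v α
  have h2 := congrArg v c.ξ_α
  have h3 := congrArg ξ c.v_α
  simp only [map_sub, Derivation.leibniz, smul_eq_mul, Derivation.map_ofNat] at *
  linear_combination h1 - h3 + h2 - p * c.ξ_α + (2 - 2 * a) * c.v_α - α * h.jacobi_u

/-- The `ξ`-derivative of the equation for `u α + v β` separates its two terms. -/
theorem ConformalComponents.two_u_α (h : FrameBrackets u v ξ a p q)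
    (c : ConformalComponents u v ξ a p q α β γ σ) (hσ : ξ σ = 0) :
    2 * u α = 2 * q * α + σ + u (v γ) - q * v γ := by
  have h1 := congrArg ξ c.div
  have h2 := h.comm_ξ_u α
  have h3 := h.comm_ξ_v β
  have h4 := congrArg u c.ξ_α
  have h5 := congrArg v c.ξ_β
  have h6 := h.comm_u_v γ
  -- all coefficients are even, and `2` is invertible in an `ℝ`-algebra
  have key : 4 * u α = 2 * (2 * q * α + σ + u (v γ) - q * v γ) := by
    simp only [map_add, map_sub, Derivation.leibniz, smul_eq_mul, Derivation.map_ofNat] at *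
    linear_combination h1 - h2 - h3 - h4 - h5 + 2 * c.div + q * c.ξ_α - p * c.ξ_β
      + α * h.jacobi_v - β * h.jacobi_u + 2 * hσ - h6 - 2 * c.ξ_γ
  have h7 := congrArg (fun z : A => (2⁻¹ : ℝ) • z) key
  have e : ∀ z : A, (2⁻¹ : ℝ) • (2 * z) = z := fun z => by
    rw [two_mul, ← two_smul ℝ z, smul_smul]; norm_num
  have h8 : 4 * u α = 2 * (2 * u α) := by ring
  rw [h8] at h7
  simpa only [e] using h7

theorem ConformalComponents.two_v_β (h : FrameBrackets u v ξ a p q)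
    (c : ConformalComponents u v ξ a p q α β γ σ) (hσ : ξ σ = 0) :
    2 * v β = -(2 * p * β) + 3 * σ - u (v γ) + q * v γ := by
  linear_combination 2 * c.div - c.two_u_α h hσ

/-- With `v α` and `u α` both known, `[u, v] α` gives one more compatibility condition, and the
curvature enters through it. -/
theorem ConformalComponents.curvature_mul_α (h : FrameBrackets u v ξ a p q)
    (c : ConformalComponents u v ξ a p q α β γ σ) (hσ : ξ σ = 0) :
    (frameCurvature u v a p q - 4) * (2 * α - v γ) = -v σ := by
  have h1 := h.comm_u_v α
  have h2 := congrArg u c.v_α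
  have h3 := congrArg v (c.two_u_α h hσ)
  have h4 := h.comm_u_v (v γ)
  have h5 := congrArg u (c.v_v_γ h)
  have h6 := h.comm_ξ_v γ
  have h7 := congrArg v c.ξ_γ
  have h9 := c.v_v_γ h
  simp only [frameCurvature, map_add, map_sub, Derivation.leibniz, smul_eq_mul,
    Derivation.map_ofNat] at *
  linear_combination 2 * h1 - 2 * h2 + h3 - h4 + h5 + 4 * c.ξ_α + 4 * q * c.v_α - 2 * q * h9
    - 2 * h6 - 2 * h7

theorem ConformalComponents.curvature_mul_β (h : FrameBrackets u v ξ a p q)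
    (c : ConformalComponents u v ξ a p q α β γ σ) (hσ : ξ σ = 0) :
    (frameCurvature u v a p q - 4) * (2 * β + u γ) = -u σ := by
  have h1 := h.comm_u_v β
  have h2 := congrArg v c.u_β
  have h3 := congrArg u (c.two_v_β h hσ)
  have h4 := h.comm_u_v (u γ)
  have h5 := congrArg v (c.u_u_γ h)
  have h6 := h.comm_ξ_u γ
  have h7 := congrArg u c.ξ_γ
  have h9 := c.u_u_γ h
  have h10 := congrArg u (h.comm_u_v γ)
  simp only [frameCurvature, map_add, map_sub, map_neg, Derivation.leibniz, smul_eq_mul,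
    Derivation.map_ofNat] at *
  linear_combination -2 * h1 - 2 * h2 + h3 - h10 - h4 - h5 - 2 * h6 - 4 * h7 - 2 * p * h9
    - 4 * c.ξ_β - 4 * p * c.u_β

/-- The `ξ`-derivative of `two_u_α`, from which all components of the field cancel. -/
theorem ConformalComponents.u_v_σ (h : FrameBrackets u v ξ a p q)
    (c : ConformalComponents u v ξ a p q α β γ σ) (hσ : ξ σ = 0) :
    u (v σ) = q * v σ + 2 * σ := by
  have h1 := h.comm_ξ_u (2 * α - v γ)
  have h2 := congrArg ξ (c.two_u_α h hσ)
  have h3 := congrArg u c.ξ_α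
  have h6 := h.comm_ξ_v γ
  have h7 := congrArg v c.ξ_γ
  have h8 := c.two_u_α h hσ
  have h9 := congrArg u (h.comm_ξ_v γ)
  have h10 := congrArg u h7
  simp only [map_add, map_sub, map_neg, Derivation.leibniz, smul_eq_mul,
    Derivation.map_ofNat, map_zero] at *
  linear_combination h1 - h2 + 2 * h3 + (v γ - 2 * α) * h.jacobi_v - 2 * q * c.ξ_α + q * h6
    + q * h7 - h9 - h10 + 2 * h8 - hσ

/-- The `ξ`-derivative of `curvature_mul_α`: the curvature function and `σ` are constant along `ξ`,
and `ξ (2 α - v γ) = (2 - a) (2 α - v γ) - v σ`, so all terms are multiples of `v σ`. -/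
theorem ConformalComponents.curvature_mul_v_σ (h : FrameBrackets u v ξ a p q)
    (c : ConformalComponents u v ξ a p q α β γ σ) (hσ : ξ σ = 0) :
    (frameCurvature u v a p q - 2) * v σ = 0 := by
  have h1 := congrArg ξ (c.curvature_mul_α h hσ)
  have h2 := h.ξ_frameCurvature
  have h4 := h.comm_ξ_v γ
  have h5 := congrArg v c.ξ_γ
  have h6 := h.comm_ξ_v σ
  have h7 := congrArg v hσ
  have h8 := c.curvature_mul_α h hσ
  generalize frameCurvature u v a p q = K at *
  simp only [map_sub, map_neg, map_zero, Derivation.leibniz, smul_eq_mul, Derivation.map_ofNat] at *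
  linear_combination (2 * α - v γ) * h2 - h1 + 2 * (K - 4) * c.ξ_α - (K - 4) * (h4 + h5)
    + (2 - a) * h8 + h6 + h7

/-- The `u`-derivative of `(K - 2) v σ = 0`, multiplied by `K - 2` to remove the derivative of
`K`, with `u v σ` replaced by its value. -/
theorem ConformalComponents.curvature_sq_mul_σ (h : FrameBrackets u v ξ a p q)
    (c : ConformalComponents u v ξ a p q α β γ σ) (hσ : ξ σ = 0) :
    2 * ((frameCurvature u v a p q - 2) ^ 2 * σ) = 0 := by
  have h1 := c.curvature_mul_v_σ h hσ
  have h2 := congrArg u h1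
  have h3 := c.u_v_σ h hσ
  generalize frameCurvature u v a p q = K at *
  simp only [map_sub, map_zero, Derivation.leibniz, smul_eq_mul, Derivation.map_ofNat] at h2
  linear_combination (K - 2) * h2 - (u K + (K - 2) * q) * h1 - (K - 2) ^ 2 * h3

end FrameAlgebra

/-! ### Calculus of vector fields -/

noncomputable section

section Calculus

variable {n : ℕ} {M : Type*} [TopologicalSpace M] [ChartedSpace (EuclideanSpace ℝ (Fin n)) M]

/-- The function `f` is smooth at the point `x`. -/
abbrev SmoothFunAt (n : ℕ) {M : Type*} [TopologicalSpace M]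
    [ChartedSpace (EuclideanSpace ℝ (Fin n)) M] (f : M → ℝ) (x : M) : Prop :=
  ContMDiffAt (𝓡 n) 𝓘(ℝ, ℝ) ∞ f x

theorem SmoothFunAt.mdifferentiableAt {f : M → ℝ} {x : M} (hf : SmoothFunAt n f x) :
    MDifferentiableAt (𝓡 n) 𝓘(ℝ, ℝ) f x :=
  ContMDiffAt.mdifferentiableAt hf (by simp)

theorem smoothFunAt_const (c : ℝ) (x : M) : SmoothFunAt n (fun _ ↦ c) x := contMDiffAt_const

theorem dirDeriv_congr {X : ∀ x : M, TangentSpace (𝓡 n) x} {f f' : M → ℝ} {x : M}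
    (h : f =ᶠ[𝓝 x] f') : dirDeriv X f x = dirDeriv X f' x := by
  simp only [dirDeriv, mvfderiv, h.mfderiv_eq]
  rfl

theorem dirDeriv_const (X : ∀ x : M, TangentSpace (𝓡 n) x) (c : ℝ) (x : M) :
    dirDeriv X (fun _ ↦ c) x = 0 := by
  simp [dirDeriv, mvfderiv_const]

theorem dirDeriv_add {X : ∀ x : M, TangentSpace (𝓡 n) x} {f f' : M → ℝ} {x : M}
    (hf : MDifferentiableAt (𝓡 n) 𝓘(ℝ, ℝ) f x) (hf' : MDifferentiableAt (𝓡 n) 𝓘(ℝ, ℝ) f' x) :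
    dirDeriv X (f + f') x = dirDeriv X f x + dirDeriv X f' x := by
  simp [dirDeriv, mvfderiv_add hf hf']

theorem dirDeriv_neg (X : ∀ x : M, TangentSpace (𝓡 n) x) (f : M → ℝ) (x : M) :
    dirDeriv X (-f) x = -dirDeriv X f x := by
  simp [dirDeriv, mvfderiv_neg]

theorem dirDeriv_mul {X : ∀ x : M, TangentSpace (𝓡 n) x} {f f' : M → ℝ} {x : M}
    (hf : MDifferentiableAt (𝓡 n) 𝓘(ℝ, ℝ) f x) (hf' : MDifferentiableAt (𝓡 n) 𝓘(ℝ, ℝ) f' x) :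
    dirDeriv X (f * f') x = f x * dirDeriv X f' x + f' x * dirDeriv X f x := by
  simp [dirDeriv, mvfderiv_mul hf hf']

theorem dirDeriv_of_eq_add {X Y₁ Y₂ Y₃ : ∀ x : M, TangentSpace (𝓡 n) x} {c₁ c₂ c₃ : ℝ}
    {x : M} (f : M → ℝ)
    (h : X x = c₁ • Y₁ x + c₂ • Y₂ x + c₃ • Y₃ x) :
    dirDeriv X f x = c₁ * dirDeriv Y₁ f x + c₂ * dirDeriv Y₂ f x + c₃ * dirDeriv Y₃ f x := by
  simp [dirDeriv, h]

theorem mlieBracket_congr {X X' Y Y' : ∀ x : M, TangentSpace (𝓡 n) x} {x : M}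
    (hX : X =ᶠ[𝓝 x] X') (hY : Y =ᶠ[𝓝 x] Y') :
    VectorField.mlieBracket (𝓡 n) X Y x = VectorField.mlieBracket (𝓡 n) X' Y' x :=
  Filter.EventuallyEq.mlieBracket_vectorField_eq hX hY

variable [IsManifold (𝓡 n) ∞ M]

theorem SmoothFieldAt.diffFieldAt {X : ∀ x : M, TangentSpace (𝓡 n) x} {x : M}
    (h : SmoothFieldAt X x) : DiffFieldAt X x :=
  ContMDiffAt.mdifferentiableAt h (by simp)

theorem SmoothFieldAt.add {X Y : ∀ x : M, TangentSpace (𝓡 n) x} {x : M}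
    (hX : SmoothFieldAt X x) (hY : SmoothFieldAt Y x) : SmoothFieldAt (X + Y) x :=
  ContMDiffAt.add_section hX hY

theorem SmoothFieldAt.smul {f : M → ℝ} {X : ∀ x : M, TangentSpace (𝓡 n) x} {x : M}
    (hf : SmoothFunAt n f x) (hX : SmoothFieldAt X x) : SmoothFieldAt (f • X) x :=
  ContMDiffAt.smul_section hf hX

theorem SmoothFieldAt.congr {X Y : ∀ x : M, TangentSpace (𝓡 n) x} {x : M}
    (hX : SmoothFieldAt X x) (h : X =ᶠ[𝓝 x] Y) : SmoothFieldAt Y x := by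
  refine ContMDiffAt.congr_of_eventuallyEq hX ?_
  filter_upwards [h] with y hy
  rw [hy]

theorem SmoothFieldAt.mlieBracket {X Y : ∀ x : M, TangentSpace (𝓡 n) x} {x : M}
    (hX : SmoothFieldAt X x) (hY : SmoothFieldAt Y x) :
    SmoothFieldAt (VectorField.mlieBracket (𝓡 n) X Y) x := by
  have : IsManifold (𝓡 n) (((⊤ : ℕ∞) : WithTop ℕ∞) + 1) M := by
    simpa using ‹IsManifold (𝓡 n) ∞ M›
  have : IsManifold (𝓡 n) (minSmoothness ℝ 2) M :=
    IsManifold.of_le (n := ∞) (by simpa using ENat.LEInfty.out)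
  exact ContMDiffAt.mlieBracket_vectorField (n := ⊤) (m := ⊤) hX hY (by simp)

theorem mlieBracket_jacobi {X Y Z : ∀ x : M, TangentSpace (𝓡 n) x} {x : M}
    (hX : SmoothFieldAt X x) (hY : SmoothFieldAt Y x) (hZ : SmoothFieldAt Z x) :
    VectorField.mlieBracket (𝓡 n) X (VectorField.mlieBracket (𝓡 n) Y Z) x =
      VectorField.mlieBracket (𝓡 n) (VectorField.mlieBracket (𝓡 n) X Y) Z x +
        VectorField.mlieBracket (𝓡 n) Y (VectorField.mlieBracket (𝓡 n) X Z) x := by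
  have : IsManifold (𝓡 n) (minSmoothness ℝ 3) M :=
    IsManifold.of_le (n := ∞) (by simpa using ENat.LEInfty.out)
  have h : minSmoothness ℝ 2 ≤ (∞ : WithTop ℕ∞) := by
    simpa using ENat.LEInfty.out
  exact VectorField.leibniz_identity_mlieBracket_apply (hX.of_le h) (hY.of_le h) (hZ.of_le h)

theorem mlieBracket_smul_right' {f : M → ℝ} {X Y : ∀ x : M, TangentSpace (𝓡 n) x} {x : M}
    (hf : MDifferentiableAt (𝓡 n) 𝓘(ℝ, ℝ) f x) (hY : DiffFieldAt Y x) :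
    VectorField.mlieBracket (𝓡 n) X (f • Y) x
      = dirDeriv X f x • Y x + f x • VectorField.mlieBracket (𝓡 n) X Y x :=
  VectorField.mlieBracket_smul_right hf hY

theorem mlieBracket_smul_left' {f : M → ℝ} {X Y : ∀ x : M, TangentSpace (𝓡 n) x} {x : M}
    (hf : MDifferentiableAt (𝓡 n) 𝓘(ℝ, ℝ) f x) (hX : DiffFieldAt X x) :
    VectorField.mlieBracket (𝓡 n) (f • X) Y x
      = -dirDeriv Y f x • X x + f x • VectorField.mlieBracket (𝓡 n) X Y x :=
  VectorField.mlieBracket_smul_left hf hX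

theorem eventually_smoothFieldAt_extend {x : M} (w : TangentSpace (𝓡 n) x) :
    ∀ᶠ y in 𝓝 x, SmoothFieldAt (FiberBundle.extend (EuclideanSpace ℝ (Fin n)) w) y := by
  obtain ⟨s, hs, h⟩ := FiberBundle.exists_contMDiffOn_extend (k := ∞) (𝓡 n)
    (EuclideanSpace ℝ (Fin n)) w
  filter_upwards [eventually_mem_nhds_iff.2 hs] with y hy
  exact h.contMDiffAt hy

theorem SemiRiemannianMetric.smooth_inner (g : SemiRiemannianMetric n M)
    {X Y : ∀ x : M, TangentSpace (𝓡 n) x} {x : M}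
    (hX : SmoothFieldAt X x) (hY : SmoothFieldAt Y x) :
    SmoothFunAt n (fun y ↦ g.inner y (X y) (Y y)) x := by
  have h := ContMDiffAt.clm_bundle_apply₂ (F₁ := EuclideanSpace ℝ (Fin n))
    (F₂ := EuclideanSpace ℝ (Fin n)) (F₃ := ℝ) (E₃ := Bundle.Trivial M ℝ)
    (g.contMDiff x) hX hY
  simp only [Bundle.contMDiffAt_totalSpace] at h
  exact h.2

namespace AlmostParacontactStructure

variable (P : AlmostParacontactStructure n M)

theorem smooth_φ {X : ∀ x : M, TangentSpace (𝓡 n) x} {x : M} (hX : SmoothFieldAt X x) :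
    SmoothFieldAt (fun y ↦ P.φ y (X y)) x :=
  ContMDiffAt.clm_bundle_apply (F₁ := EuclideanSpace ℝ (Fin n))
    (F₂ := EuclideanSpace ℝ (Fin n)) (P.contMDiff_φ x) hX

theorem smooth_η {X : ∀ x : M, TangentSpace (𝓡 n) x} {x : M} (hX : SmoothFieldAt X x) :
    SmoothFunAt n (fun y ↦ P.η y (X y)) x := by
  have h := ContMDiffAt.clm_bundle_apply (F₁ := EuclideanSpace ℝ (Fin n))
    (F₂ := ℝ) (E₂ := Bundle.Trivial M ℝ) (P.contMDiff_η x) hX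
  simp only [Bundle.contMDiffAt_totalSpace] at h
  exact h.2

/-- The derivative of a function along `X` expressed through brackets of vector fields, by the
Leibniz rule for `[X, f ξ]` and `η(ξ) = 1`. It transfers smoothness and the Jacobi identity from
brackets to derivatives of functions. -/
theorem dirDeriv_eq {f : M → ℝ} {X : ∀ x : M, TangentSpace (𝓡 n) x} {x : M}
    (hf : MDifferentiableAt (𝓡 n) 𝓘(ℝ, ℝ) f x) :
    dirDeriv X f x = P.η x (VectorField.mlieBracket (𝓡 n) X (f • P.ξ) x)
      - f x * P.η x (VectorField.mlieBracket (𝓡 n) X P.ξ x) := by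
  rw [mlieBracket_smul_right' hf (P.contMDiff_ξ x).diffFieldAt]
  simp [P.η_ξ]

theorem smooth_dirDeriv (P : AlmostParacontactStructure n M)
    {f : M → ℝ} {X : ∀ x : M, TangentSpace (𝓡 n) x} {U : Set M}
    (hU : IsOpen U) (hf : ∀ y ∈ U, SmoothFunAt n f y) (hX : ∀ y ∈ U, SmoothFieldAt X y) :
    ∀ y ∈ U, SmoothFunAt n (dirDeriv X f) y := by
  intro y hy
  have h1 : SmoothFunAt n (fun z ↦ P.η z (VectorField.mlieBracket (𝓡 n) X (f • P.ξ) z)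
      - f z * P.η z (VectorField.mlieBracket (𝓡 n) X P.ξ z)) y :=
    ContMDiffAt.sub (P.smooth_η ((hX y hy).mlieBracket (.smul (hf y hy) (P.contMDiff_ξ y))))
      ((hf y hy).mul (P.smooth_η ((hX y hy).mlieBracket (P.contMDiff_ξ y))))
  refine h1.congr_of_eventuallyEq ?_
  filter_upwards [hU.mem_nhds hy] with z hz
  exact P.dirDeriv_eq (hf z hz).mdifferentiableAt

/-- The bracket of two fields acts on functions as the commutator: the `ξ`-component of the Jacobi
identity for `X`, `Y` and `f ξ`. -/
theorem dirDeriv_mlieBracket (P : AlmostParacontactStructure n M)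
    {f : M → ℝ} {X Y : ∀ x : M, TangentSpace (𝓡 n) x} {U : Set M}
    (hU : IsOpen U) (hf : ∀ y ∈ U, SmoothFunAt n f y) (hX : ∀ y ∈ U, SmoothFieldAt X y)
    (hY : ∀ y ∈ U, SmoothFieldAt Y y) {x : M} (hx : x ∈ U) :
    dirDeriv (VectorField.mlieBracket (𝓡 n) X Y) f x
      = dirDeriv X (dirDeriv Y f) x - dirDeriv Y (dirDeriv X f) x := by
  have hξ := P.contMDiff_ξ x
  have hfx := (hf x hx).mdifferentiableAt
  have key : ∀ {X Y : ∀ x : M, TangentSpace (𝓡 n) x}, (∀ y ∈ U, SmoothFieldAt X y) →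
      (∀ y ∈ U, SmoothFieldAt Y y) →
      VectorField.mlieBracket (𝓡 n) X (VectorField.mlieBracket (𝓡 n) Y (f • P.ξ)) x
        = dirDeriv X (dirDeriv Y f) x • P.ξ x
          + dirDeriv Y f x • VectorField.mlieBracket (𝓡 n) X P.ξ x
          + (dirDeriv X f x • VectorField.mlieBracket (𝓡 n) Y P.ξ x
          + f x • VectorField.mlieBracket (𝓡 n) X (VectorField.mlieBracket (𝓡 n) Y P.ξ) x) := by
    intro X Y hX hY
    have e : VectorField.mlieBracket (𝓡 n) Y (f • P.ξ) =ᶠ[𝓝 x]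
        dirDeriv Y f • P.ξ + f • VectorField.mlieBracket (𝓡 n) Y P.ξ := by
      filter_upwards [hU.mem_nhds hx] with z hz
      exact mlieBracket_smul_right' (hf z hz).mdifferentiableAt (P.contMDiff_ξ z).diffFieldAt
    have hYf := P.smooth_dirDeriv hU hf hY x hx
    have hYξ := (hY x hx).mlieBracket hξ
    rw [mlieBracket_congr (Filter.EventuallyEq.refl _ X) e,
      VectorField.mlieBracket_add_right (SmoothFieldAt.smul hYf hξ).diffFieldAt
        (SmoothFieldAt.smul (hf x hx) hYξ).diffFieldAt,
      mlieBracket_smul_right' hYf.mdifferentiableAt hξ.diffFieldAt,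
      mlieBracket_smul_right' hfx hYξ.diffFieldAt]
  have h1 := mlieBracket_jacobi (hX x hx) (hY x hx) (SmoothFieldAt.smul (hf x hx) hξ)
  rw [key hX hY, key hY hX, mlieBracket_smul_right' hfx hξ.diffFieldAt,
    mlieBracket_jacobi (hX x hx) (hY x hx) hξ] at h1
  have h2 := congrArg (P.η x) h1
  simp only [map_add, map_smul, smul_eq_mul, P.η_ξ] at h2
  linarith

end AlmostParacontactStructure
end Calculus

/-! ### The Levi-Civita connection and its curvature operator -/

namespace SemiRiemannianMetric

variable {n : ℕ} {M : Type*} [TopologicalSpace M] [ChartedSpace (EuclideanSpace ℝ (Fin n)) M]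
  [IsManifold (𝓡 n) ∞ M] (g : SemiRiemannianMetric n M)

theorem ext_inner {x : M} {w w' : TangentSpace (𝓡 n) x}
    (h : ∀ Z : ∀ x : M, TangentSpace (𝓡 n) x, DiffFieldAt Z x →
      g.inner x w (Z x) = g.inner x w' (Z x)) : w = w' := by
  refine sub_eq_zero.1 (g.nondegenerate x _ fun z ↦ ?_)
  have := h (FiberBundle.extend (EuclideanSpace ℝ (Fin n)) z)
    (FiberBundle.mdifferentiableAt_extend (𝓡 n) (EuclideanSpace ℝ (Fin n)) z)
  simp only [FiberBundle.extend_apply_self] at this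
  simp [this]

theorem koszul_congr {X X' Y Y' Z : ∀ x : M, TangentSpace (𝓡 n) x} {x : M}
    (hX : X =ᶠ[𝓝 x] X') (hY : Y =ᶠ[𝓝 x] Y') : g.koszul X Y Z x = g.koszul X' Y' Z x := by
  have h1 : dirDeriv X (fun y ↦ g.inner y (Y y) (Z y)) x
      = dirDeriv X' (fun y ↦ g.inner y (Y' y) (Z y)) x := by
    simp only [dirDeriv, hX.eq_of_nhds]
    refine dirDeriv_congr (X := X') ?_
    filter_upwards [hY] with y hy
    rw [hy]
  have h2 : dirDeriv Y (fun y ↦ g.inner y (X y) (Z y)) x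
      = dirDeriv Y' (fun y ↦ g.inner y (X' y) (Z y)) x := by
    simp only [dirDeriv, hY.eq_of_nhds]
    refine dirDeriv_congr (X := Y') ?_
    filter_upwards [hX] with y hy
    rw [hy]
  have h3 : dirDeriv Z (fun y ↦ g.inner y (X y) (Y y)) x
      = dirDeriv Z (fun y ↦ g.inner y (X' y) (Y' y)) x := by
    refine dirDeriv_congr ?_
    filter_upwards [hX, hY] with y hy hy'
    rw [hy, hy']
  simp only [koszul, h1, h2, h3, mlieBracket_congr hX hY,
    mlieBracket_congr hX (Filter.EventuallyEq.refl _ Z),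
    mlieBracket_congr hY (Filter.EventuallyEq.refl _ Z), hX.eq_of_nhds, hY.eq_of_nhds]

theorem leviCivita_congr {X X' Y Y' : ∀ x : M, TangentSpace (𝓡 n) x} {x : M}
    (hX : X =ᶠ[𝓝 x] X') (hY : Y =ᶠ[𝓝 x] Y') : g.leviCivita X Y x = g.leviCivita X' Y' x := by
  simp only [leviCivita, g.koszul_congr hX hY]

variable {X X' Y Y' : ∀ x : M, TangentSpace (𝓡 n) x} {x : M}

/-- The defining property of the Levi-Civita connection, in the form in which its linearity and
Leibniz rules are verified. -/
theorem leviCivita_eq_iff (hX : DiffFieldAt X x) (hY : DiffFieldAt Y x)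
    {w : TangentSpace (𝓡 n) x} :
    g.leviCivita X Y x = w ↔ ∀ Z : ∀ x : M, TangentSpace (𝓡 n) x, DiffFieldAt Z x →
      g.koszul X Y Z x = 2 * g.inner x w (Z x) := by
  constructor
  · rintro rfl Z hZ
    exact (g.two_mul_inner_leviCivita hX hY hZ).symm
  · intro h
    refine g.ext_inner fun Z hZ ↦ ?_
    linarith [h Z hZ, g.two_mul_inner_leviCivita hX hY hZ]

theorem _root_.DiffFieldAt.add (hX : DiffFieldAt X x) (hY : DiffFieldAt Y x) :
    DiffFieldAt (X + Y) x :=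
  mdifferentiableAt_add_section hX hY

theorem _root_.DiffFieldAt.smul {f : M → ℝ} (hf : MDifferentiableAt (𝓡 n) 𝓘(ℝ, ℝ) f x)
    (hX : DiffFieldAt X x) : DiffFieldAt (f • X) x :=
  MDifferentiableAt.smul_section hf hX

theorem leviCivita_add_left (hX : DiffFieldAt X x) (hX' : DiffFieldAt X' x)
    (hY : DiffFieldAt Y x) :
    g.leviCivita (X + X') Y x = g.leviCivita X Y x + g.leviCivita X' Y x := by
  rw [g.leviCivita_eq_iff (hX.add hX') hY]
  intro Z hZ
  rw [map_add, add_apply, mul_add, g.two_mul_inner_leviCivita hX hY hZ,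
    g.two_mul_inner_leviCivita hX' hY hZ]
  have h1 : (fun y ↦ g.inner y ((X + X') y) (Z y))
      = (fun y ↦ g.inner y (X y) (Z y)) + fun y ↦ g.inner y (X' y) (Z y) := by ext y; simp
  have h2 : (fun y ↦ g.inner y ((X + X') y) (Y y))
      = (fun y ↦ g.inner y (X y) (Y y)) + fun y ↦ g.inner y (X' y) (Y y) := by ext y; simp
  simp only [koszul, h1, h2,
    dirDeriv_add (g.mdifferentiableAt_inner hX hZ) (g.mdifferentiableAt_inner hX' hZ),
    dirDeriv_add (g.mdifferentiableAt_inner hX hY) (g.mdifferentiableAt_inner hX' hY),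
    VectorField.mlieBracket_add_left hX hX']
  simp [dirDeriv]
  ring

theorem leviCivita_add_right (hX : DiffFieldAt X x) (hY : DiffFieldAt Y x)
    (hY' : DiffFieldAt Y' x) :
    g.leviCivita X (Y + Y') x = g.leviCivita X Y x + g.leviCivita X Y' x := by
  rw [g.leviCivita_eq_iff hX (hY.add hY')]
  intro Z hZ
  rw [map_add, add_apply, mul_add, g.two_mul_inner_leviCivita hX hY hZ,
    g.two_mul_inner_leviCivita hX hY' hZ]
  have h1 : (fun y ↦ g.inner y ((Y + Y') y) (Z y))
      = (fun y ↦ g.inner y (Y y) (Z y)) + fun y ↦ g.inner y (Y' y) (Z y) := by ext y; simp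
  have h2 : (fun y ↦ g.inner y (X y) ((Y + Y') y))
      = (fun y ↦ g.inner y (X y) (Y y)) + fun y ↦ g.inner y (X y) (Y' y) := by ext y; simp
  simp only [koszul, h1, h2,
    dirDeriv_add (g.mdifferentiableAt_inner hY hZ) (g.mdifferentiableAt_inner hY' hZ),
    dirDeriv_add (g.mdifferentiableAt_inner hX hY) (g.mdifferentiableAt_inner hX hY'),
    VectorField.mlieBracket_add_left hY hY', VectorField.mlieBracket_add_right hY hY']
  simp [dirDeriv]
  ring

theorem leviCivita_smul_left {f : M → ℝ} (hf : MDifferentiableAt (𝓡 n) 𝓘(ℝ, ℝ) f x)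
    (hX : DiffFieldAt X x) (hY : DiffFieldAt Y x) :
    g.leviCivita (f • X) Y x = f x • g.leviCivita X Y x := by
  rw [g.leviCivita_eq_iff (hX.smul hf) hY]
  intro Z hZ
  rw [map_smul, smul_apply, smul_eq_mul, mul_left_comm,
    g.two_mul_inner_leviCivita hX hY hZ]
  have h1 : (fun y ↦ g.inner y ((f • X) y) (Z y)) = f * fun y ↦ g.inner y (X y) (Z y) := by
    ext y; simp
  have h2 : (fun y ↦ g.inner y ((f • X) y) (Y y)) = f * fun y ↦ g.inner y (X y) (Y y) := by
    ext y; simp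
  simp only [koszul, h1, h2, dirDeriv_mul hf (g.mdifferentiableAt_inner hX hZ),
    dirDeriv_mul hf (g.mdifferentiableAt_inner hX hY), mlieBracket_smul_left' hf hX]
  simp [dirDeriv]
  ring

theorem leviCivita_smul_right {f : M → ℝ} (hf : MDifferentiableAt (𝓡 n) 𝓘(ℝ, ℝ) f x)
    (hX : DiffFieldAt X x) (hY : DiffFieldAt Y x) :
    g.leviCivita X (f • Y) x = dirDeriv X f x • Y x + f x • g.leviCivita X Y x := by
  rw [g.leviCivita_eq_iff hX (hY.smul hf)]
  intro Z hZ
  rw [map_add, add_apply, mul_add, map_smul, map_smul,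
    smul_apply, smul_apply, smul_eq_mul, smul_eq_mul,
    mul_left_comm _ (f x), g.two_mul_inner_leviCivita hX hY hZ]
  have h1 : (fun y ↦ g.inner y ((f • Y) y) (Z y)) = f * fun y ↦ g.inner y (Y y) (Z y) := by
    ext y; simp
  have h2 : (fun y ↦ g.inner y (X y) ((f • Y) y)) = f * fun y ↦ g.inner y (X y) (Y y) := by
    ext y; simp
  simp only [koszul, h1, h2, dirDeriv_mul hf (g.mdifferentiableAt_inner hY hZ),
    dirDeriv_mul hf (g.mdifferentiableAt_inner hX hY), mlieBracket_smul_left' hf hY,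
    mlieBracket_smul_right' hf hY]
  simp [dirDeriv, g.symm x (Y x)]
  ring

theorem curvature_swap {Z : ∀ x : M, TangentSpace (𝓡 n) x} (hX : SmoothFieldAt X x)
    (hY : SmoothFieldAt Y x) (hZ : SmoothFieldAt Z x) :
    
    g.curvature X Y Z x = -g.curvature Y X Z x := by
  have e : VectorField.mlieBracket (𝓡 n) X Y
      = (fun _ : M ↦ (-1 : ℝ)) • VectorField.mlieBracket (𝓡 n) Y X := by
    rw [VectorField.mlieBracket_swap]
    ext1 y
    exact (neg_one_smul ℝ (VectorField.mlieBracket (𝓡 n) Y X y)).symm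
  rw [curvature, curvature, e,
    g.leviCivita_smul_left mdifferentiableAt_const (hY.mlieBracket hX).diffFieldAt hZ.diffFieldAt]
  module

theorem curvature_self {Z : ∀ x : M, TangentSpace (𝓡 n) x} (hX : SmoothFieldAt X x)
    (hZ : SmoothFieldAt Z x) :
    g.curvature X X Z x = 0 := by
  simpa [self_eq_neg, ← two_smul ℝ] using add_eq_zero_iff_eq_neg.2 (g.curvature_swap hX hX hZ)

end SemiRiemannianMetric

/-! ### Null frames and their brackets -/

namespace AlmostParacontactStructure

section Pointwise

variable {n : ℕ} {M : Type*} [TopologicalSpace M] [ChartedSpace (EuclideanSpace ℝ (Fin n)) M]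
  [IsManifold (𝓡 n) ∞ M] (P : AlmostParacontactStructure n M)

theorem φ_ξ (x : M) : P.φ x (P.ξ x) = 0 := by
  have h1 : P.φ x (P.φ x (P.ξ x)) = 0 := by rw [P.φ_sq, P.η_ξ, one_smul, sub_self]
  have h2 := P.φ_sq x (P.φ x (P.ξ x))
  rw [h1, map_zero, eq_comm, sub_eq_zero] at h2
  have h3 : P.η x (P.φ x (P.ξ x)) • P.φ x (P.ξ x) = 0 := by
    rw [← map_smul, ← h2, h1]
  rcases smul_eq_zero.1 h3 with h | h
  · rw [h2, h, zero_smul]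
  · exact h

theorem η_φ (x : M) (w : TangentSpace (𝓡 n) x) : P.η x (P.φ x w) = 0 := by
  have h1 := congrArg (P.φ x) (P.φ_sq x w)
  rw [map_sub, map_smul, P.φ_ξ, smul_zero, sub_zero, P.φ_sq x (P.φ x w), sub_eq_self] at h1
  simpa [P.η_ξ] using congrArg (P.η x) h1

variable {P} {g : SemiRiemannianMetric n M}

theorem IsCompatible.inner_ξ (h : P.IsCompatible g) (x : M) (w : TangentSpace (𝓡 n) x) :
    g.inner x w (P.ξ x) = P.η x w := by
  have := h x w (P.ξ x)
  rw [P.φ_ξ, map_zero, P.η_ξ] at this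
  linarith

theorem IsCompatible.inner_φ_left (h : P.IsCompatible g) (x : M) (w z : TangentSpace (𝓡 n) x) :
    g.inner x (P.φ x w) z = -g.inner x w (P.φ x z) := by
  have := h x w (P.φ x z)
  rw [P.φ_sq, map_sub, map_smul, h.inner_ξ, P.η_φ, P.η_φ] at this
  simpa using this

end Pointwise

variable {M : Type*} [TopologicalSpace M] [ChartedSpace (EuclideanSpace ℝ (Fin 3)) M]
  [IsManifold (𝓡 3) ∞ M]

/-- A smooth null frame of `ker η` on the open set `U`: eigenvector fields `u` and `v` of `φ` for
the eigenvalues `1` and `-1`, normalised by `g(u, v) = 1`. With `ξ` they frame the tangent bundle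
over `U`; outside `U` their values are irrelevant. -/
structure NullFrame (P : AlmostParacontactStructure 3 M) (g : SemiRiemannianMetric 3 M)
    (U : Set M) where
  u : ∀ x : M, TangentSpace (𝓡 3) x
  v : ∀ x : M, TangentSpace (𝓡 3) x
  isOpen : IsOpen U
  smooth_u : ∀ x ∈ U, SmoothFieldAt u x
  smooth_v : ∀ x ∈ U, SmoothFieldAt v x
  φ_u : ∀ x ∈ U, P.φ x (u x) = u x
  φ_v : ∀ x ∈ U, P.φ x (v x) = -v x
  inner_u_v : ∀ x ∈ U, g.inner x (u x) (v x) = 1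

namespace NullFrame

variable {P : AlmostParacontactStructure 3 M} {g : SemiRiemannianMetric 3 M} {U : Set M}
  (F : NullFrame P g U)

/-- The restriction of a null frame to a smaller open set. -/
def restrict {U' : Set M} (hU' : IsOpen U') (h : U' ⊆ U) : NullFrame P g U' where
  u := F.u
  v := F.v
  isOpen := hU'
  smooth_u x hx := F.smooth_u x (h hx)
  smooth_v x hx := F.smooth_v x (h hx)
  φ_u x hx := F.φ_u x (h hx)
  φ_v x hx := F.φ_v x (h hx)
  inner_u_v x hx := F.inner_u_v x (h hx)

variable {x : M}

theorem η_u (hx : x ∈ U) : P.η x (F.u x) = 0 := by rw [← F.φ_u x hx, P.η_φ]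

theorem η_v (hx : x ∈ U) : P.η x (F.v x) = 0 := by
  have := P.η_φ x (F.v x)
  rwa [F.φ_v x hx, map_neg, neg_eq_zero] at this

theorem inner_v_u (hx : x ∈ U) : g.inner x (F.v x) (F.u x) = 1 := by
  rw [g.symm, F.inner_u_v x hx]

theorem inner_u_u (h : P.IsCompatible g) (hx : x ∈ U) : g.inner x (F.u x) (F.u x) = 0 := by
  have := h x (F.u x) (F.u x)
  rw [F.φ_u x hx, F.η_u hx] at this
  linarith

theorem inner_v_v (h : P.IsCompatible g) (hx : x ∈ U) : g.inner x (F.v x) (F.v x) = 0 := by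
  have := h x (F.v x) (F.v x)
  rw [F.φ_v x hx, F.η_v hx] at this
  simp only [map_neg, neg_apply, neg_neg] at this
  linarith

/-- The components of a vector in a null frame are its products with the frame. -/
theorem decomp (h : P.IsCompatible g) (hx : x ∈ U) (w : TangentSpace (𝓡 3) x) :
    w = g.inner x w (F.v x) • F.u x + g.inner x w (F.u x) • F.v x + P.η x w • P.ξ x := by
  have huu := F.inner_u_u h hx
  have hvv := F.inner_v_v h hx
  have huv := F.inner_u_v x hx
  have hvu := F.inner_v_u hx
  have hu := F.η_u hx
  have hv := F.η_v hx
  have hξ := P.η_ξ x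
  have hgξ : ∀ w, g.inner x (P.ξ x) w = P.η x w := fun w ↦ by rw [g.symm, h.inner_ξ]
  have li : LinearIndependent ℝ ![F.u x, F.v x, P.ξ x] := by
    rw [Fintype.linearIndependent_iff]
    intro c hc
    rw [Fin.sum_univ_three] at hc
    simp only [Matrix.cons_val_zero, Matrix.cons_val_one, Matrix.cons_val] at hc
    have h0 := congrArg (fun w ↦ g.inner x w (F.v x)) hc
    have h1 := congrArg (fun w ↦ g.inner x w (F.u x)) hc
    have h2 := congrArg (P.η x) hc
    simp [huu, hvv, huv, hvu, hu, hv, hξ, hgξ] at h0 h1 h2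
    intro i
    fin_cases i
    exacts [h0, h1, h2]
  have hspan : w ∈ Submodule.span ℝ (Set.range ![F.u x, F.v x, P.ξ x]) := by
    rw [li.span_eq_top_of_card_eq_finrank' (by
      rw [Fintype.card_fin]
      exact (finrank_euclideanSpace_fin (𝕜 := ℝ) (n := 3)).symm)]
    trivial
  obtain ⟨c, rfl⟩ := (Submodule.mem_span_range_iff_exists_fun ℝ).1 hspan
  simp [Fin.sum_univ_three, huu, hvv, huv, hvu, hu, hv, hξ, hgξ]

/-- The function with `[ξ, u] = a u`, written as a component of `[ξ, u]`. -/
def a : M → ℝ := fun x ↦ g.inner x (VectorField.mlieBracket (𝓡 3) P.ξ F.u x) (F.v x)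

/-- The function with `[ξ, v] = b v`, written as a component of `[ξ, v]`; it equals `-a`. -/
def b : M → ℝ := fun x ↦ g.inner x (VectorField.mlieBracket (𝓡 3) P.ξ F.v x) (F.u x)

/-- The coefficient of `u` in `[u, v]`. -/
def p : M → ℝ := fun x ↦ g.inner x (VectorField.mlieBracket (𝓡 3) F.u F.v x) (F.v x)

/-- The coefficient of `v` in `[u, v]`. -/
def q : M → ℝ := fun x ↦ g.inner x (VectorField.mlieBracket (𝓡 3) F.u F.v x) (F.u x)

theorem smooth_a : ∀ x ∈ U, SmoothFunAt 3 F.a x := fun x hx ↦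
  g.smooth_inner ((P.contMDiff_ξ x).mlieBracket (F.smooth_u x hx)) (F.smooth_v x hx)

theorem smooth_b : ∀ x ∈ U, SmoothFunAt 3 F.b x := fun x hx ↦
  g.smooth_inner ((P.contMDiff_ξ x).mlieBracket (F.smooth_v x hx)) (F.smooth_u x hx)

theorem smooth_p : ∀ x ∈ U, SmoothFunAt 3 F.p x := fun x hx ↦
  g.smooth_inner ((F.smooth_u x hx).mlieBracket (F.smooth_v x hx)) (F.smooth_v x hx)

theorem smooth_q : ∀ x ∈ U, SmoothFunAt 3 F.q x := fun x hx ↦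
  g.smooth_inner ((F.smooth_u x hx).mlieBracket (F.smooth_v x hx)) (F.smooth_u x hx)

theorem eventuallyEq_of_eqOn (F : NullFrame P g U) {β : Type*} {f f' : M → β}
    (h : ∀ x ∈ U, f x = f' x) (hx : x ∈ U) :
    f =ᶠ[𝓝 x] f' :=
  Filter.eventuallyEq_of_mem (F.isOpen.mem_nhds hx) h

theorem dirDeriv_of_eqOn_const (F : NullFrame P g U) (X : ∀ x : M, TangentSpace (𝓡 3) x)
    {f : M → ℝ} {c : ℝ} (h : ∀ x ∈ U, f x = c) (hx : x ∈ U) : dirDeriv X f x = 0 := by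
  rw [dirDeriv_congr (F.eventuallyEq_of_eqOn h hx), dirDeriv_const]

/-- Normality makes the flow of `ξ` preserve the line fields spanned by `u` and `v`. -/
theorem mlieBracket_ξ_u (h : P.IsParaSasakian g) (hx : x ∈ U) :
    VectorField.mlieBracket (𝓡 3) P.ξ F.u x = F.a x • F.u x := by
  set b := VectorField.mlieBracket (𝓡 3) P.ξ F.u x with hb
  have hd := h.1.2 x P.ξ F.u (P.contMDiff_ξ x) (F.smooth_u x hx)
  have hdη : extDerivForm P.η P.ξ F.u x = 0 := by
    rw [hd, fundamentalForm, F.φ_u x hx, g.symm, h.1.1.inner_ξ, F.η_u hx]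
  have hη : P.η x b = 0 := by
    have h1 := F.dirDeriv_of_eqOn_const P.ξ (f := fun y ↦ P.η y (F.u y)) (fun y hy ↦ F.η_u hy) hx
    have h2 := F.dirDeriv_of_eqOn_const F.u (f := fun y ↦ P.η y (P.ξ y)) (fun y hy ↦ P.η_ξ y) hx
    rw [extDerivForm, h1, h2, ← hb] at hdη
    linarith
  have hN := h.2 x P.ξ F.u (P.contMDiff_ξ x) (F.smooth_u x hx)
  have e0 : (fun y ↦ P.φ y (P.ξ y)) = 0 := funext P.φ_ξ
  have e1 := mlieBracket_congr (Filter.EventuallyEq.refl _ P.ξ)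
    (F.eventuallyEq_of_eqOn (f := fun y ↦ P.φ y (F.u y)) F.φ_u hx)
  simp only [nijenhuis, e0, VectorField.mlieBracket_zero_left, e1, hdη, ← hb, Pi.zero_apply,
    map_zero, mul_zero, zero_smul, add_zero, sub_zero, P.φ_sq, hη] at hN
  have hφ : P.φ x b = b := (sub_eq_zero.1 hN).symm
  have hbu : g.inner x b (F.u x) = 0 := by
    have := h.1.1 x b (F.u x)
    rw [hφ, F.φ_u x hx, hη] at this
    linarith
  rw [F.decomp h.1.1 hx b, hη, hbu, zero_smul, zero_smul, add_zero, add_zero]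
  rfl

/-- The coefficient of `ξ` in `[u, v]` comes from `dη(u, v) = g(u, φ v) = -1`. -/
theorem mlieBracket_u_v (h : P.IsParaSasakian g) (hx : x ∈ U) :
    VectorField.mlieBracket (𝓡 3) F.u F.v x
      = (2 : ℝ) • P.ξ x + F.p x • F.u x + F.q x • F.v x := by
  set b := VectorField.mlieBracket (𝓡 3) F.u F.v x with hb
  have hd := h.1.2 x F.u F.v (F.smooth_u x hx) (F.smooth_v x hx)
  have hη : P.η x b = 2 := by
    have h1 := F.dirDeriv_of_eqOn_const F.u (f := fun y ↦ P.η y (F.v y)) (fun y hy ↦ F.η_v hy) hx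
    have h2 := F.dirDeriv_of_eqOn_const F.v (f := fun y ↦ P.η y (F.u y)) (fun y hy ↦ F.η_u hy) hx
    rw [extDerivForm, h1, h2, ← hb, fundamentalForm, F.φ_v x hx, map_neg,
      F.inner_u_v x hx] at hd
    linarith
  rw [F.decomp h.1.1 hx b, hη]
  simp only [p, q, ← hb]
  abel

theorem mlieBracket_ξ_v_of_normal (h : P.IsParaSasakian g) (hx : x ∈ U) :
    VectorField.mlieBracket (𝓡 3) P.ξ F.v x = F.b x • F.v x := by
  set b := VectorField.mlieBracket (𝓡 3) P.ξ F.v x with hb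
  have hd := h.1.2 x P.ξ F.v (P.contMDiff_ξ x) (F.smooth_v x hx)
  have hdη : extDerivForm P.η P.ξ F.v x = 0 := by
    rw [hd, fundamentalForm, F.φ_v x hx, g.symm, h.1.1.inner_ξ, map_neg, F.η_v hx, neg_zero]
  have hη : P.η x b = 0 := by
    have h1 := F.dirDeriv_of_eqOn_const P.ξ (f := fun y ↦ P.η y (F.v y)) (fun y hy ↦ F.η_v hy) hx
    have h2 := F.dirDeriv_of_eqOn_const F.v (f := fun y ↦ P.η y (P.ξ y)) (fun y hy ↦ P.η_ξ y) hx
    rw [extDerivForm, h1, h2, ← hb] at hdη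
    linarith
  have hN := h.2 x P.ξ F.v (P.contMDiff_ξ x) (F.smooth_v x hx)
  have e0 : (fun y ↦ P.φ y (P.ξ y)) = 0 := funext P.φ_ξ
  have e1 := mlieBracket_congr (Filter.EventuallyEq.refl _ P.ξ)
    (F.eventuallyEq_of_eqOn (f := fun y ↦ P.φ y (F.v y)) (f' := (-1 : ℝ) • F.v)
      (fun y hy ↦ (F.φ_v y hy).trans (neg_one_smul ℝ (F.v y)).symm) hx)
  rw [VectorField.mlieBracket_const_smul_right (F.smooth_v x hx).diffFieldAt, ← hb] at e1
  simp only [nijenhuis, e0, VectorField.mlieBracket_zero_left, e1, hdη, ← hb, Pi.zero_apply,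
    map_zero, mul_zero, zero_smul, add_zero, sub_zero, P.φ_sq, hη, map_smul] at hN
  have hφ : P.φ x b = -b := by
    rw [neg_one_smul, sub_neg_eq_add] at hN
    exact eq_neg_of_add_eq_zero_right hN
  have hbv : g.inner x b (F.v x) = 0 := by
    have := h.1.1 x b (F.v x)
    rw [hφ, F.φ_v x hx, hη] at this
    simp only [map_neg, neg_apply, neg_neg] at this
    linarith
  rw [F.decomp h.1.1 hx b, hη, hbv, zero_smul, zero_smul, add_zero, zero_add]
  rfl

/-- The components along `ξ`, `u` and `v` of the Jacobi identity for `ξ`, `u` and `v`. -/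
theorem jacobi (h : P.IsParaSasakian g) (hx : x ∈ U) :
    F.b x = -F.a x ∧ dirDeriv P.ξ F.p x + F.p x * F.a x = -dirDeriv F.v F.a x ∧
      dirDeriv P.ξ F.q x - F.q x * F.a x = dirDeriv F.u F.b x := by
  have sξ := P.contMDiff_ξ x
  have su := F.smooth_u x hx
  have sv := F.smooth_v x hx
  have e1 : VectorField.mlieBracket (𝓡 3) F.u F.v =ᶠ[𝓝 x]
      (2 : ℝ) • P.ξ + F.p • F.u + F.q • F.v :=
    F.eventuallyEq_of_eqOn (fun y hy ↦ F.mlieBracket_u_v h hy) hx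
  have e2 : VectorField.mlieBracket (𝓡 3) P.ξ F.u =ᶠ[𝓝 x] F.a • F.u :=
    F.eventuallyEq_of_eqOn (fun y hy ↦ F.mlieBracket_ξ_u h hy) hx
  have e3 : VectorField.mlieBracket (𝓡 3) P.ξ F.v =ᶠ[𝓝 x] F.b • F.v :=
    F.eventuallyEq_of_eqOn (fun y hy ↦ F.mlieBracket_ξ_v_of_normal h hy) hx
  have da := (F.smooth_a x hx).mdifferentiableAt
  have db := (F.smooth_b x hx).mdifferentiableAt
  have dp := (F.smooth_p x hx).mdifferentiableAt
  have dq := (F.smooth_q x hx).mdifferentiableAt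
  have d2 : DiffFieldAt ((2 : ℝ) • P.ξ) x :=
    SmoothFieldAt.diffFieldAt (ContMDiffAt.const_smul_section sξ)
  have J := mlieBracket_jacobi sξ su sv
  rw [mlieBracket_congr (Filter.EventuallyEq.refl _ P.ξ) e1,
    mlieBracket_congr e2 (Filter.EventuallyEq.refl _ F.v),
    mlieBracket_congr (Filter.EventuallyEq.refl _ F.u) e3,
    VectorField.mlieBracket_add_right (d2.add (su.diffFieldAt.smul dp)) (sv.diffFieldAt.smul dq),
    VectorField.mlieBracket_add_right d2 (su.diffFieldAt.smul dp),
    VectorField.mlieBracket_const_smul_right sξ.diffFieldAt,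
    mlieBracket_smul_right' dp su.diffFieldAt, mlieBracket_smul_right' dq sv.diffFieldAt,
    mlieBracket_smul_left' da su.diffFieldAt, mlieBracket_smul_right' db sv.diffFieldAt,
    F.mlieBracket_ξ_u h hx, F.mlieBracket_ξ_v_of_normal h hx, F.mlieBracket_u_v h hx,
    VectorField.mlieBracket_self] at J
  have hξu : g.inner x (P.ξ x) (F.u x) = 0 := by rw [g.symm, h.1.1.inner_ξ, F.η_u hx]
  have hξv : g.inner x (P.ξ x) (F.v x) = 0 := by rw [g.symm, h.1.1.inner_ξ, F.η_v hx]
  have J0 := congrArg (P.η x) J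
  have J1 := congrArg (fun w ↦ g.inner x w (F.v x)) J
  have J2 := congrArg (fun w ↦ g.inner x w (F.u x)) J
  simp [F.η_u hx, F.η_v hx, P.η_ξ, F.inner_u_u h.1.1 hx, F.inner_v_v h.1.1 hx,
    F.inner_u_v x hx, F.inner_v_u hx, hξu, hξv] at J0 J1 J2
  have hb : F.b x = -F.a x := by linarith
  refine ⟨hb, ?_, ?_⟩
  · rw [hb] at J1
    linarith
  · rw [hb] at J2
    linarith

theorem b_eq (h : P.IsParaSasakian g) (hx : x ∈ U) : F.b x = -F.a x := (F.jacobi h hx).1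

theorem mlieBracket_ξ_v (h : P.IsParaSasakian g) (hx : x ∈ U) :
    VectorField.mlieBracket (𝓡 3) P.ξ F.v x = -F.a x • F.v x := by
  rw [F.mlieBracket_ξ_v_of_normal h hx, F.b_eq h hx]

theorem jacobi_u (h : P.IsParaSasakian g) (hx : x ∈ U) :
    dirDeriv P.ξ F.p x + F.p x * F.a x = -dirDeriv F.v F.a x := (F.jacobi h hx).2.1

theorem jacobi_v (h : P.IsParaSasakian g) (hx : x ∈ U) :
    dirDeriv P.ξ F.q x - F.q x * F.a x = -dirDeriv F.u F.a x := by
  rw [(F.jacobi h hx).2.2, ← dirDeriv_neg]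
  exact dirDeriv_congr (F.eventuallyEq_of_eqOn (fun y hy ↦ F.b_eq h hy) hx)

end NullFrame
end AlmostParacontactStructure

/-! ### Existence of null frames and the connection in a null frame -/

namespace AlmostParacontactStructure

variable {M : Type*} [TopologicalSpace M] [ChartedSpace (EuclideanSpace ℝ (Fin 3)) M]
  [IsManifold (𝓡 3) ∞ M] (P : AlmostParacontactStructure 3 M)
  {g : SemiRiemannianMetric 3 M}

/-- Since `φ` is an involution of `ker η`, one of its two eigenspaces there is nontrivial; they have
equal dimension, so both are. -/
theorem exists_φ_eq_self (x : M) : ∃ w : TangentSpace (𝓡 3) x, w ≠ 0 ∧ P.φ x w = w := by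
  have hk : LinearMap.ker (P.η x).toLinearMap ≠ ⊥ := by
    apply LinearMap.ker_ne_bot_of_finrank_lt
    have : Module.finrank ℝ (TangentSpace (𝓡 3) x) = 3 :=
      finrank_euclideanSpace_fin (𝕜 := ℝ) (n := 3)
    rw [this, Module.finrank_self]
    norm_num
  obtain ⟨w, hw, hw0⟩ := (Submodule.ne_bot_iff _).1 hk
  have hηw : P.η x w = 0 := hw
  have hφφ : P.φ x (P.φ x w) = w := by rw [P.φ_sq, hηw, zero_smul, sub_zero]
  by_cases hp : w + P.φ x w = 0
  · -- `w` is then an eigenvector for `-1`, so the eigenspace for `1` is nontrivial as well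
    have hm : w ∈ Module.End.eigenspace (P.φ x).toLinearMap (-1 : ℝ)
        ⊓ LinearMap.ker (P.η x).toLinearMap := by
      refine ⟨Module.End.mem_eigenspace_iff.2 ?_, hw⟩
      rw [neg_one_smul]
      exact eq_neg_of_add_eq_zero_right hp
    have hpos := P.finrank_eigen x
    by_contra! hne
    have hbot : Module.End.eigenspace (P.φ x).toLinearMap (1 : ℝ)
        ⊓ LinearMap.ker (P.η x).toLinearMap = ⊥ := by
      rw [Submodule.eq_bot_iff]
      intro z hz
      by_contra hz0
      exact hne z hz0 (by simpa using Module.End.mem_eigenspace_iff.1 hz.1)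
    rw [hbot, finrank_bot, eq_comm, Submodule.finrank_eq_zero] at hpos
    rw [hpos] at hm
    exact hw0 hm
  · exact ⟨_, hp, by rw [map_add, hφφ, add_comm]⟩

variable {P}

/-- Null frames exist near every point: with `W` and `Z` extending vectors at the point, the fields
`φ² W + φ W` and `φ² Z - φ Z` are eigenvector fields of `φ`, and their product is nonzero nearby if
it is nonzero at the point. -/
theorem IsCompatible.exists_nullFrame (h : P.IsCompatible g) (x : M) :
    ∃ U : Set M, x ∈ U ∧ Nonempty (NullFrame P g U) := by
  obtain ⟨w, hw0, hw⟩ := P.exists_φ_eq_self x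
  obtain ⟨z, hz⟩ : ∃ z, g.inner x w z ≠ 0 := by
    by_contra! hne
    exact hw0 (g.nondegenerate x w hne)
  have hsq : ∀ (y : M) (b : TangentSpace (𝓡 3) y), P.φ y (P.φ y (P.φ y b)) = P.φ y b :=
    fun y b ↦ by rw [P.φ_sq, P.η_φ, zero_smul, sub_zero]
  let W := FiberBundle.extend (EuclideanSpace ℝ (Fin 3)) w
  let Z := FiberBundle.extend (EuclideanSpace ℝ (Fin 3)) z
  let φφ : (∀ x : M, TangentSpace (𝓡 3) x) → ∀ x : M, TangentSpace (𝓡 3) x :=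
    fun X y ↦ P.φ y (P.φ y (X y))
  let u : ∀ x : M, TangentSpace (𝓡 3) x := φφ W + fun y ↦ P.φ y (W y)
  let v : ∀ x : M, TangentSpace (𝓡 3) x := φφ Z + (-1 : ℝ) • fun y ↦ P.φ y (Z y)
  let f : M → ℝ := fun y ↦ g.inner y (u y) (v y)
  have su : ∀ {y}, SmoothFieldAt W y → SmoothFieldAt u y := fun hy ↦
    SmoothFieldAt.add (P.smooth_φ (P.smooth_φ hy)) (P.smooth_φ hy)
  have sv : ∀ {y}, SmoothFieldAt Z y → SmoothFieldAt v y := fun hy ↦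
    SmoothFieldAt.add (P.smooth_φ (P.smooth_φ hy))
      (ContMDiffAt.const_smul_section (P.smooth_φ hy))
  have hW := eventually_smoothFieldAt_extend w
  have hZ := eventually_smoothFieldAt_extend z
  have hfx : f x ≠ 0 := by
    have e1 : u x = w + w := by simp [u, φφ, W, hw]
    have e2 : v x = P.φ x (P.φ x z) - P.φ x z := by simp [v, φφ, Z, sub_eq_add_neg]
    have e3 : g.inner x w (P.φ x z) = -g.inner x w z := by
      rw [eq_neg_iff_add_eq_zero]
      have := h.inner_φ_left x w z
      rw [hw] at this
      linarith
    have e4 : g.inner x w (P.φ x (P.φ x z)) = g.inner x w z := by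
      have := h.inner_φ_left x w (P.φ x z)
      rw [hw] at this
      linarith
    simp only [f, e1, e2, map_add, map_sub, add_apply, e3, e4]
    contrapose! hz
    linarith
  have hf : ∀ᶠ y in 𝓝 x, f y ≠ 0 :=
    (g.smooth_inner (su hW.self_of_nhds) (sv hZ.self_of_nhds)).continuousAt.eventually_ne hfx
  obtain ⟨U, hU, hUo, hxU⟩ := eventually_nhds_iff.1 (hW.and (hZ.and hf))
  refine ⟨U, hxU, ⟨{
    u := u
    v := f⁻¹ • v
    isOpen := hUo
    smooth_u := fun y hy ↦ su (hU y hy).1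
    smooth_v := fun y hy ↦ ?_
    φ_u := fun y hy ↦ ?_
    φ_v := fun y hy ↦ ?_
    inner_u_v := fun y hy ↦ ?_ }⟩⟩
  · obtain ⟨h1, h2, h3⟩ := hU y hy
    exact SmoothFieldAt.smul (ContMDiffAt.inv₀ (g.smooth_inner (su h1) (sv h2)) h3) (sv h2)
  · simp only [u, φφ, Pi.add_apply, map_add, hsq]
    exact add_comm _ _
  · simp only [v, φφ, Pi.add_apply, Pi.smul_apply', Pi.smul_apply, map_add, map_smul, hsq]
    module
  · simp only [Pi.smul_apply', map_smul, Pi.inv_apply, smul_eq_mul]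
    exact inv_mul_cancel₀ (hU y hy).2.2

namespace NullFrame

variable {U : Set M} (F : NullFrame P g U) {x : M}

theorem mlieBracket_u_ξ (h : P.IsParaSasakian g) (hx : x ∈ U) :
    VectorField.mlieBracket (𝓡 3) F.u P.ξ x = -F.a x • F.u x := by
  rw [VectorField.mlieBracket_swap_apply, F.mlieBracket_ξ_u h hx, neg_smul]

theorem mlieBracket_v_ξ (h : P.IsParaSasakian g) (hx : x ∈ U) :
    VectorField.mlieBracket (𝓡 3) F.v P.ξ x = F.a x • F.v x := by
  rw [VectorField.mlieBracket_swap_apply, F.mlieBracket_ξ_v h hx, neg_smul, neg_neg]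

theorem mlieBracket_v_u (h : P.IsParaSasakian g) (hx : x ∈ U) :
    VectorField.mlieBracket (𝓡 3) F.v F.u x
      = -((2 : ℝ) • P.ξ x + F.p x • F.u x + F.q x • F.v x) := by
  rw [VectorField.mlieBracket_swap_apply, F.mlieBracket_u_v h hx]

theorem inner_ξ_u (h : P.IsCompatible g) (hx : x ∈ U) : g.inner x (P.ξ x) (F.u x) = 0 := by
  rw [g.symm, h.inner_ξ, F.η_u hx]

theorem inner_ξ_v (h : P.IsCompatible g) (hx : x ∈ U) : g.inner x (P.ξ x) (F.v x) = 0 := by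
  rw [g.symm, h.inner_ξ, F.η_v hx]

theorem koszul_of_inner_const (F : NullFrame P g U) {X Y Z : ∀ x : M, TangentSpace (𝓡 3) x}
    {c₁ c₂ c₃ : ℝ}
    (h₁ : ∀ y ∈ U, g.inner y (Y y) (Z y) = c₁) (h₂ : ∀ y ∈ U, g.inner y (X y) (Z y) = c₂)
    (h₃ : ∀ y ∈ U, g.inner y (X y) (Y y) = c₃) (hx : x ∈ U) :
    g.koszul X Y Z x = g.inner x (VectorField.mlieBracket (𝓡 3) X Y x) (Z x)
      - g.inner x (VectorField.mlieBracket (𝓡 3) X Z x) (Y x)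
      - g.inner x (VectorField.mlieBracket (𝓡 3) Y Z x) (X x) := by
  rw [SemiRiemannianMetric.koszul, F.dirDeriv_of_eqOn_const X h₁ hx,
    F.dirDeriv_of_eqOn_const Y h₂ hx, F.dirDeriv_of_eqOn_const Z h₃ hx]
  ring

/-- The components of `∇_X Y` in a null frame, by the Koszul formula. -/
theorem leviCivita_eq_koszul (h : P.IsCompatible g) {X Y : ∀ x : M, TangentSpace (𝓡 3) x}
    (hx : x ∈ U) (hX : DiffFieldAt X x) (hY : DiffFieldAt Y x) :
    g.leviCivita X Y x = (g.koszul X Y F.v x / 2) • F.u x + (g.koszul X Y F.u x / 2) • F.v x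
      + (g.koszul X Y P.ξ x / 2) • P.ξ x := by
  rw [← g.two_mul_inner_leviCivita hX hY (F.smooth_v x hx).diffFieldAt,
    ← g.two_mul_inner_leviCivita hX hY (F.smooth_u x hx).diffFieldAt,
    ← g.two_mul_inner_leviCivita hX hY (P.contMDiff_ξ x).diffFieldAt,
    h.inner_ξ]
  simp only [mul_div_cancel_left₀ _ (two_ne_zero (α := ℝ))]
  exact F.decomp h hx _

theorem leviCivita_of_inner_const (h : P.IsCompatible g) {X Y : ∀ x : M, TangentSpace (𝓡 3) x}
    {c c₁ c₂ c₃ d₁ d₂ d₃ : ℝ} (hX : ∀ y ∈ U, SmoothFieldAt X y) (hY : ∀ y ∈ U, SmoothFieldAt Y y)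
    (hc : ∀ y ∈ U, g.inner y (X y) (Y y) = c)
    (hc₁ : ∀ y ∈ U, g.inner y (X y) (F.u y) = c₁) (hd₁ : ∀ y ∈ U, g.inner y (Y y) (F.u y) = d₁)
    (hc₂ : ∀ y ∈ U, g.inner y (X y) (F.v y) = c₂) (hd₂ : ∀ y ∈ U, g.inner y (Y y) (F.v y) = d₂)
    (hc₃ : ∀ y ∈ U, g.inner y (X y) (P.ξ y) = c₃) (hd₃ : ∀ y ∈ U, g.inner y (Y y) (P.ξ y) = d₃)
    (hx : x ∈ U) :
    g.leviCivita X Y x =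
      ((g.inner x (VectorField.mlieBracket (𝓡 3) X Y x) (F.v x)
        - g.inner x (VectorField.mlieBracket (𝓡 3) X F.v x) (Y x)
        - g.inner x (VectorField.mlieBracket (𝓡 3) Y F.v x) (X x)) / 2) • F.u x
      + ((g.inner x (VectorField.mlieBracket (𝓡 3) X Y x) (F.u x)
        - g.inner x (VectorField.mlieBracket (𝓡 3) X F.u x) (Y x)
        - g.inner x (VectorField.mlieBracket (𝓡 3) Y F.u x) (X x)) / 2) • F.v x
      + ((g.inner x (VectorField.mlieBracket (𝓡 3) X Y x) (P.ξ x)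
        - g.inner x (VectorField.mlieBracket (𝓡 3) X P.ξ x) (Y x)
        - g.inner x (VectorField.mlieBracket (𝓡 3) Y P.ξ x) (X x)) / 2) • P.ξ x := by
  rw [F.leviCivita_eq_koszul h hx (hX x hx).diffFieldAt (hY x hx).diffFieldAt,
    F.koszul_of_inner_const hd₁ hc₁ hc hx, F.koszul_of_inner_const hd₂ hc₂ hc hx,
    F.koszul_of_inner_const hd₃ hc₃ hc hx]

/-- The Levi-Civita connection in a null frame. -/
theorem leviCivita_frame (h : P.IsParaSasakian g) (hx : x ∈ U) :
    (g.leviCivita F.u F.u x = -F.q x • F.u x ∧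
      g.leviCivita F.u F.v x = F.q x • F.v x + P.ξ x ∧
      g.leviCivita F.u P.ξ x = -F.u x) ∧
    (g.leviCivita F.v F.u x = -P.ξ x - F.p x • F.u x ∧
      g.leviCivita F.v F.v x = F.p x • F.v x ∧
      g.leviCivita F.v P.ξ x = F.v x) ∧
    (g.leviCivita P.ξ F.u x = (F.a x - 1) • F.u x ∧
      g.leviCivita P.ξ F.v x = (1 - F.a x) • F.v x ∧
      g.leviCivita P.ξ P.ξ x = 0) := by
  have c := h.1.1
  have huu := fun y (hy : y ∈ U) ↦ F.inner_u_u c hy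
  have huv := F.inner_u_v
  have hvu := fun y (hy : y ∈ U) ↦ F.inner_v_u hy
  have hvv := fun y (hy : y ∈ U) ↦ F.inner_v_v c hy
  have hξu := fun y (hy : y ∈ U) ↦ F.inner_ξ_u c hy
  have hξv := fun y (hy : y ∈ U) ↦ F.inner_ξ_v c hy
  have huξ : ∀ y ∈ U, g.inner y (F.u y) (P.ξ y) = 0 := fun y hy ↦ by rw [g.symm, hξu y hy]
  have hvξ : ∀ y ∈ U, g.inner y (F.v y) (P.ξ y) = 0 := fun y hy ↦ by rw [g.symm, hξv y hy]
  have hξξ : ∀ y ∈ U, g.inner y (P.ξ y) (P.ξ y) = 1 := fun y _ ↦ by rw [c.inner_ξ, P.η_ξ]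
  have sξ := fun y (_ : y ∈ U) ↦ P.contMDiff_ξ y
  have su := F.smooth_u
  have sv := F.smooth_v
  rw [F.leviCivita_of_inner_const c su su huu huu huu huv huv huξ huξ hx,
    F.leviCivita_of_inner_const c su sv huv huu hvu huv hvv huξ hvξ hx,
    F.leviCivita_of_inner_const c su sξ huξ huu hξu huv hξv huξ hξξ hx,
    F.leviCivita_of_inner_const c sv su hvu hvu huu hvv huv hvξ huξ hx,
    F.leviCivita_of_inner_const c sv sv hvv hvu hvu hvv hvv hvξ hvξ hx,
    F.leviCivita_of_inner_const c sv sξ hvξ hvu hξu hvv hξv hvξ hξξ hx,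
    F.leviCivita_of_inner_const c sξ su hξu hξu huu hξv huv hξξ huξ hx,
    F.leviCivita_of_inner_const c sξ sv hξv hξu hvu hξv hvv hξξ hvξ hx,
    F.leviCivita_of_inner_const c sξ sξ hξξ hξu hξu hξv hξv hξξ hξξ hx]
  simp only [F.mlieBracket_u_v h hx, F.mlieBracket_v_u h hx, F.mlieBracket_ξ_u h hx,
    F.mlieBracket_u_ξ h hx, F.mlieBracket_ξ_v h hx, F.mlieBracket_v_ξ h hx,
    VectorField.mlieBracket_self, Pi.zero_apply, map_zero, zero_apply, map_add, map_smul, map_neg,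
    add_apply, smul_apply, neg_apply, smul_eq_mul, huu x hx, huv x hx, hvu x hx, hvv x hx,
    hξu x hx, hξv x hx, huξ x hx, hvξ x hx, hξξ x hx]
  refine ⟨⟨?_, ?_, ?_⟩, ⟨?_, ?_, ?_⟩, ?_, ?_, ?_⟩ <;> module

end NullFrame
end AlmostParacontactStructure

/-! ### The curvature operator on a null frame -/

namespace AlmostParacontactStructure
namespace NullFrame

variable {M : Type*} [TopologicalSpace M] [ChartedSpace (EuclideanSpace ℝ (Fin 3)) M]
  [IsManifold (𝓡 3) ∞ M] {P : AlmostParacontactStructure 3 M}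
  {g : SemiRiemannianMetric 3 M} {U : Set M} {x : M}
  {X Y Z X' Z' : ∀ x : M, TangentSpace (𝓡 3) x} {f : M → ℝ}

theorem smooth_koszul (F : NullFrame P g U) (hX : ∀ y ∈ U, SmoothFieldAt X y)
    (hY : ∀ y ∈ U, SmoothFieldAt Y y) (hZ : ∀ y ∈ U, SmoothFieldAt Z y) :
    ∀ y ∈ U, SmoothFunAt 3 (g.koszul X Y Z) y := by
  intro y hy
  have d : ∀ {X Y Z : ∀ x : M, TangentSpace (𝓡 3) x}, (∀ y ∈ U, SmoothFieldAt X y) →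
      (∀ y ∈ U, SmoothFieldAt Y y) → (∀ y ∈ U, SmoothFieldAt Z y) →
      SmoothFunAt 3 (dirDeriv X fun z ↦ g.inner z (Y z) (Z z)) y := fun hX hY hZ ↦
    P.smooth_dirDeriv F.isOpen (fun z hz ↦ g.smooth_inner (hY z hz) (hZ z hz)) hX y hy
  have b : ∀ {X Y Z : ∀ x : M, TangentSpace (𝓡 3) x}, (∀ y ∈ U, SmoothFieldAt X y) →
      (∀ y ∈ U, SmoothFieldAt Y y) → (∀ y ∈ U, SmoothFieldAt Z y) →
      SmoothFunAt 3 (fun z ↦ g.inner z (VectorField.mlieBracket (𝓡 3) X Y z) (Z z)) y :=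
    fun hX hY hZ ↦ g.smooth_inner ((hX y hy).mlieBracket (hY y hy)) (hZ y hy)
  exact (((((d hX hY hZ).add (d hY hX hZ)).sub (d hZ hX hY)).add (b hX hY hZ)).sub
    (b hX hZ hY)).sub (b hY hZ hX)

theorem smooth_leviCivita (F : NullFrame P g U) (h : P.IsCompatible g)
    (hX : ∀ y ∈ U, SmoothFieldAt X y)
    (hY : ∀ y ∈ U, SmoothFieldAt Y y) : ∀ y ∈ U, SmoothFieldAt (g.leviCivita X Y) y := by
  intro y hy
  have sξ := fun y (_ : y ∈ U) ↦ P.contMDiff_ξ y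
  refine SmoothFieldAt.congr (X := (fun z ↦ g.koszul X Y F.v z / 2) • F.u
    + (fun z ↦ g.koszul X Y F.u z / 2) • F.v + (fun z ↦ g.koszul X Y P.ξ z / 2) • P.ξ) ?_
    (F.eventuallyEq_of_eqOn (fun z hz ↦ (F.leviCivita_eq_koszul h hz (hX z hz).diffFieldAt
      (hY z hz).diffFieldAt).symm) hy)
  exact ((SmoothFieldAt.smul ((F.smooth_koszul hX hY F.smooth_v y hy).div_const 2)
    (F.smooth_u y hy)).add (SmoothFieldAt.smul ((F.smooth_koszul hX hY F.smooth_u y hy).div_const 2)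
    (F.smooth_v y hy))).add (SmoothFieldAt.smul ((F.smooth_koszul hX hY sξ y hy).div_const 2)
    (sξ y hy))

theorem curvature_congr (F : NullFrame P g U) (hx : x ∈ U)
    {X' Y' Z' : ∀ x : M, TangentSpace (𝓡 3) x}
    (hX : ∀ y ∈ U, X y = X' y) (hY : ∀ y ∈ U, Y y = Y' y) (hZ : ∀ y ∈ U, Z y = Z' y) :
    g.curvature X Y Z x = g.curvature X' Y' Z' x := by
  have eX := fun y hy ↦ F.eventuallyEq_of_eqOn (x := y) hX hy
  have eY := fun y hy ↦ F.eventuallyEq_of_eqOn (x := y) hY hy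
  have eZ := fun y hy ↦ F.eventuallyEq_of_eqOn (x := y) hZ hy
  have e1 := F.eventuallyEq_of_eqOn (f := g.leviCivita Y Z)
    (f' := g.leviCivita Y' Z') (fun y hy ↦ g.leviCivita_congr (eY y hy) (eZ y hy)) hx
  have e2 := F.eventuallyEq_of_eqOn (f := g.leviCivita X Z)
    (f' := g.leviCivita X' Z') (fun y hy ↦ g.leviCivita_congr (eX y hy) (eZ y hy)) hx
  have e3 := F.eventuallyEq_of_eqOn (f := VectorField.mlieBracket (𝓡 3) X Y)
    (f' := VectorField.mlieBracket (𝓡 3) X' Y')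
    (fun y hy ↦ mlieBracket_congr (eX y hy) (eY y hy)) hx
  rw [SemiRiemannianMetric.curvature, g.leviCivita_congr (eX x hx) e1,
    g.leviCivita_congr (eY x hx) e2, g.leviCivita_congr e3 (eZ x hx)]
  rfl

theorem curvature_add_left (F : NullFrame P g U) (h : P.IsCompatible g) (hx : x ∈ U)
    (hX : ∀ y ∈ U, SmoothFieldAt X y)
    (hX' : ∀ y ∈ U, SmoothFieldAt X' y) (hY : ∀ y ∈ U, SmoothFieldAt Y y)
    (hZ : ∀ y ∈ U, SmoothFieldAt Z y) :
    g.curvature (X + X') Y Z x = g.curvature X Y Z x + g.curvature X' Y Z x := by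
  have dX := (hX x hx).diffFieldAt
  have dX' := (hX' x hx).diffFieldAt
  have dY := (hY x hx).diffFieldAt
  have dZ := (hZ x hx).diffFieldAt
  have e1 : g.leviCivita (X + X') Z =ᶠ[𝓝 x] g.leviCivita X Z + g.leviCivita X' Z :=
    F.eventuallyEq_of_eqOn (fun y hy ↦ g.leviCivita_add_left (hX y hy).diffFieldAt
      (hX' y hy).diffFieldAt (hZ y hy).diffFieldAt) hx
  have e2 : VectorField.mlieBracket (𝓡 3) (X + X') Y =ᶠ[𝓝 x]
      VectorField.mlieBracket (𝓡 3) X Y + VectorField.mlieBracket (𝓡 3) X' Y :=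
    F.eventuallyEq_of_eqOn (fun y hy ↦ VectorField.mlieBracket_add_left (hX y hy).diffFieldAt
      (hX' y hy).diffFieldAt) hx
  simp only [SemiRiemannianMetric.curvature]
  rw [g.leviCivita_add_left dX dX' (F.smooth_leviCivita h hY hZ x hx).diffFieldAt,
    g.leviCivita_congr (Filter.EventuallyEq.refl _ Y) e1,
    g.leviCivita_add_right dY (F.smooth_leviCivita h hX hZ x hx).diffFieldAt
      (F.smooth_leviCivita h hX' hZ x hx).diffFieldAt,
    g.leviCivita_congr e2 (Filter.EventuallyEq.refl _ Z),
    g.leviCivita_add_left ((hX x hx).mlieBracket (hY x hx)).diffFieldAt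
      ((hX' x hx).mlieBracket (hY x hx)).diffFieldAt dZ]
  module

theorem curvature_smul_left (F : NullFrame P g U) (h : P.IsCompatible g) (hx : x ∈ U)
    (hf : ∀ y ∈ U, SmoothFunAt 3 f y)
    (hX : ∀ y ∈ U, SmoothFieldAt X y) (hY : ∀ y ∈ U, SmoothFieldAt Y y)
    (hZ : ∀ y ∈ U, SmoothFieldAt Z y) :
    g.curvature (f • X) Y Z x = f x • g.curvature X Y Z x := by
  have df := (hf x hx).mdifferentiableAt
  have dX := (hX x hx).diffFieldAt
  have dY := (hY x hx).diffFieldAt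
  have dZ := (hZ x hx).diffFieldAt
  have dXY := ((hX x hx).mlieBracket (hY x hx)).diffFieldAt
  have sYf : SmoothFunAt 3 (-dirDeriv Y f) x := (P.smooth_dirDeriv F.isOpen hf hY x hx).neg
  have e1 : g.leviCivita (f • X) Z =ᶠ[𝓝 x] f • g.leviCivita X Z :=
    F.eventuallyEq_of_eqOn (fun y hy ↦ g.leviCivita_smul_left (hf y hy).mdifferentiableAt
      (hX y hy).diffFieldAt (hZ y hy).diffFieldAt) hx
  have e2 : VectorField.mlieBracket (𝓡 3) (f • X) Y =ᶠ[𝓝 x]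
      (-dirDeriv Y f) • X + f • VectorField.mlieBracket (𝓡 3) X Y :=
    F.eventuallyEq_of_eqOn (fun y hy ↦ mlieBracket_smul_left' (hf y hy).mdifferentiableAt
      (hX y hy).diffFieldAt) hx
  simp only [SemiRiemannianMetric.curvature]
  rw [g.leviCivita_smul_left df dX (F.smooth_leviCivita h hY hZ x hx).diffFieldAt,
    g.leviCivita_congr (Filter.EventuallyEq.refl _ Y) e1,
    g.leviCivita_smul_right df dY (F.smooth_leviCivita h hX hZ x hx).diffFieldAt,
    g.leviCivita_congr e2 (Filter.EventuallyEq.refl _ Z),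
    g.leviCivita_add_left (dX.smul sYf.mdifferentiableAt) (dXY.smul df) dZ,
    g.leviCivita_smul_left sYf.mdifferentiableAt dX dZ, g.leviCivita_smul_left df dXY dZ,
    Pi.neg_apply]
  module

theorem curvature_add_right (F : NullFrame P g U) (h : P.IsCompatible g) (hx : x ∈ U)
    (hX : ∀ y ∈ U, SmoothFieldAt X y)
    (hY : ∀ y ∈ U, SmoothFieldAt Y y) (hZ : ∀ y ∈ U, SmoothFieldAt Z y)
    (hZ' : ∀ y ∈ U, SmoothFieldAt Z' y) :
    g.curvature X Y (Z + Z') x = g.curvature X Y Z x + g.curvature X Y Z' x := by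
  have e : ∀ {X : ∀ x : M, TangentSpace (𝓡 3) x}, (∀ y ∈ U, SmoothFieldAt X y) →
      g.leviCivita X (Z + Z') =ᶠ[𝓝 x] g.leviCivita X Z + g.leviCivita X Z' := fun hX ↦
    F.eventuallyEq_of_eqOn (fun y hy ↦ g.leviCivita_add_right (hX y hy).diffFieldAt
      (hZ y hy).diffFieldAt (hZ' y hy).diffFieldAt) hx
  simp only [SemiRiemannianMetric.curvature]
  rw [g.leviCivita_congr (Filter.EventuallyEq.refl _ X) (e hY),
    g.leviCivita_congr (Filter.EventuallyEq.refl _ Y) (e hX),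
    g.leviCivita_add_right (hX x hx).diffFieldAt (F.smooth_leviCivita h hY hZ x hx).diffFieldAt
      (F.smooth_leviCivita h hY hZ' x hx).diffFieldAt,
    g.leviCivita_add_right (hY x hx).diffFieldAt (F.smooth_leviCivita h hX hZ x hx).diffFieldAt
      (F.smooth_leviCivita h hX hZ' x hx).diffFieldAt,
    g.leviCivita_add_right ((hX x hx).mlieBracket (hY x hx)).diffFieldAt (hZ x hx).diffFieldAt
      (hZ' x hx).diffFieldAt]
  module

theorem curvature_smul_right (F : NullFrame P g U) (h : P.IsCompatible g) (hx : x ∈ U)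
    (hf : ∀ y ∈ U, SmoothFunAt 3 f y)
    (hX : ∀ y ∈ U, SmoothFieldAt X y) (hY : ∀ y ∈ U, SmoothFieldAt Y y)
    (hZ : ∀ y ∈ U, SmoothFieldAt Z y) :
    g.curvature X Y (f • Z) x = f x • g.curvature X Y Z x := by
  have df := (hf x hx).mdifferentiableAt
  have dX := (hX x hx).diffFieldAt
  have dY := (hY x hx).diffFieldAt
  have dZ := (hZ x hx).diffFieldAt
  have e : ∀ {X : ∀ x : M, TangentSpace (𝓡 3) x}, (∀ y ∈ U, SmoothFieldAt X y) →
      g.leviCivita X (f • Z) =ᶠ[𝓝 x] dirDeriv X f • Z + f • g.leviCivita X Z := fun hX ↦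
    F.eventuallyEq_of_eqOn (fun y hy ↦ g.leviCivita_smul_right (hf y hy).mdifferentiableAt
      (hX y hy).diffFieldAt (hZ y hy).diffFieldAt) hx
  have dXf := (P.smooth_dirDeriv F.isOpen hf hX x hx).mdifferentiableAt
  have dYf := (P.smooth_dirDeriv F.isOpen hf hY x hx).mdifferentiableAt
  have dXZ := (F.smooth_leviCivita h hX hZ x hx).diffFieldAt
  have dYZ := (F.smooth_leviCivita h hY hZ x hx).diffFieldAt
  simp only [SemiRiemannianMetric.curvature]
  rw [g.leviCivita_congr (Filter.EventuallyEq.refl _ X) (e hY),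
    g.leviCivita_congr (Filter.EventuallyEq.refl _ Y) (e hX),
    g.leviCivita_add_right dX (dZ.smul dYf) (dYZ.smul df),
    g.leviCivita_add_right dY (dZ.smul dXf) (dXZ.smul df),
    g.leviCivita_smul_right dYf dX dZ, g.leviCivita_smul_right dXf dY dZ,
    g.leviCivita_smul_right df dX dYZ, g.leviCivita_smul_right df dY dXZ,
    g.leviCivita_smul_right df ((hX x hx).mlieBracket (hY x hx)).diffFieldAt dZ,
    P.dirDeriv_mlieBracket F.isOpen hf hX hY hx]
  module

/-- The curvature function `u p - v q - 2 p q + 2 a` of the frame, the pointwise form of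
`frameCurvature`. It is `(2 - r) / 2` and so does not depend on the frame. -/
def K (F : NullFrame P g U) : M → ℝ := fun x ↦
  dirDeriv F.u F.p x - dirDeriv F.v F.q x - 2 * F.p x * F.q x + 2 * F.a x

/-- The Levi-Civita derivative of a combination of the frame fields. -/
theorem leviCivita_comb (F : NullFrame P g U) {c₁ c₂ c₃ : M → ℝ} (hx : x ∈ U)
    (hX : SmoothFieldAt X x)
    (h₁ : SmoothFunAt 3 c₁ x) (h₂ : SmoothFunAt 3 c₂ x) (h₃ : SmoothFunAt 3 c₃ x) :
    g.leviCivita X (c₁ • F.u + c₂ • F.v + c₃ • P.ξ) x =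
      dirDeriv X c₁ x • F.u x + c₁ x • g.leviCivita X F.u x
      + (dirDeriv X c₂ x • F.v x + c₂ x • g.leviCivita X F.v x)
      + (dirDeriv X c₃ x • P.ξ x + c₃ x • g.leviCivita X P.ξ x) := by
  have dX := hX.diffFieldAt
  have du := (F.smooth_u x hx).diffFieldAt
  have dv := (F.smooth_v x hx).diffFieldAt
  have dξ := (P.contMDiff_ξ x).diffFieldAt
  have d₁ := h₁.mdifferentiableAt
  have d₂ := h₂.mdifferentiableAt
  have d₃ := h₃.mdifferentiableAt
  rw [g.leviCivita_add_right dX ((du.smul d₁).add (dv.smul d₂)) (dξ.smul d₃),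
    g.leviCivita_add_right dX (du.smul d₁) (dv.smul d₂), g.leviCivita_smul_right d₁ dX du,
    g.leviCivita_smul_right d₂ dX dv, g.leviCivita_smul_right d₃ dX dξ]

theorem leviCivita_comb_left (F : NullFrame P g U) {c₁ c₂ c₃ : M → ℝ} (hx : x ∈ U)
    (hZ : SmoothFieldAt Z x)
    (h₁ : SmoothFunAt 3 c₁ x) (h₂ : SmoothFunAt 3 c₂ x) (h₃ : SmoothFunAt 3 c₃ x) :
    g.leviCivita (c₁ • F.u + c₂ • F.v + c₃ • P.ξ) Z x =
      c₁ x • g.leviCivita F.u Z x + c₂ x • g.leviCivita F.v Z x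
      + c₃ x • g.leviCivita P.ξ Z x := by
  have dZ := hZ.diffFieldAt
  have du := (F.smooth_u x hx).diffFieldAt
  have dv := (F.smooth_v x hx).diffFieldAt
  have dξ := (P.contMDiff_ξ x).diffFieldAt
  have d₁ := h₁.mdifferentiableAt
  have d₂ := h₂.mdifferentiableAt
  have d₃ := h₃.mdifferentiableAt
  rw [g.leviCivita_add_left ((du.smul d₁).add (dv.smul d₂)) (dξ.smul d₃) dZ,
    g.leviCivita_add_left (du.smul d₁) (dv.smul d₂) dZ, g.leviCivita_smul_left d₁ du dZ,
    g.leviCivita_smul_left d₂ dv dZ, g.leviCivita_smul_left d₃ dξ dZ]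

/-- The curvature in terms of the frame components of `∇_Y Z`, `∇_X Z` and `[X, Y]`. -/
theorem curvature_comb (F : NullFrame P g U) {a₁ a₂ a₃ b₁ b₂ b₃ c₁ c₂ c₃ : M → ℝ} (hx : x ∈ U)
    (hX : SmoothFieldAt X x) (hY : SmoothFieldAt Y x) (hZ : SmoothFieldAt Z x)
    (ha : ∀ y ∈ U, g.leviCivita Y Z y = a₁ y • F.u y + a₂ y • F.v y + a₃ y • P.ξ y)
    (hb : ∀ y ∈ U, g.leviCivita X Z y = b₁ y • F.u y + b₂ y • F.v y + b₃ y • P.ξ y)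
    (hc : ∀ y ∈ U, VectorField.mlieBracket (𝓡 3) X Y y
      = c₁ y • F.u y + c₂ y • F.v y + c₃ y • P.ξ y)
    (ha₁ : SmoothFunAt 3 a₁ x) (ha₂ : SmoothFunAt 3 a₂ x) (ha₃ : SmoothFunAt 3 a₃ x)
    (hb₁ : SmoothFunAt 3 b₁ x) (hb₂ : SmoothFunAt 3 b₂ x) (hb₃ : SmoothFunAt 3 b₃ x)
    (hc₁ : SmoothFunAt 3 c₁ x) (hc₂ : SmoothFunAt 3 c₂ x) (hc₃ : SmoothFunAt 3 c₃ x) :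
    g.curvature X Y Z x =
      (dirDeriv X a₁ x • F.u x + a₁ x • g.leviCivita X F.u x
      + (dirDeriv X a₂ x • F.v x + a₂ x • g.leviCivita X F.v x)
      + (dirDeriv X a₃ x • P.ξ x + a₃ x • g.leviCivita X P.ξ x))
      - (dirDeriv Y b₁ x • F.u x + b₁ x • g.leviCivita Y F.u x
      + (dirDeriv Y b₂ x • F.v x + b₂ x • g.leviCivita Y F.v x)
      + (dirDeriv Y b₃ x • P.ξ x + b₃ x • g.leviCivita Y P.ξ x))
      - (c₁ x • g.leviCivita F.u Z x + c₂ x • g.leviCivita F.v Z x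
      + c₃ x • g.leviCivita P.ξ Z x) := by
  have ea : g.leviCivita Y Z =ᶠ[𝓝 x] a₁ • F.u + a₂ • F.v + a₃ • P.ξ :=
    F.eventuallyEq_of_eqOn ha hx
  have eb : g.leviCivita X Z =ᶠ[𝓝 x] b₁ • F.u + b₂ • F.v + b₃ • P.ξ :=
    F.eventuallyEq_of_eqOn hb hx
  have ec : VectorField.mlieBracket (𝓡 3) X Y =ᶠ[𝓝 x] c₁ • F.u + c₂ • F.v + c₃ • P.ξ :=
    F.eventuallyEq_of_eqOn hc hx
  rw [SemiRiemannianMetric.curvature, g.leviCivita_congr (Filter.EventuallyEq.refl _ X) ea,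
    g.leviCivita_congr (Filter.EventuallyEq.refl _ Y) eb,
    g.leviCivita_congr ec (Filter.EventuallyEq.refl _ Z),
    F.leviCivita_comb hx hX ha₁ ha₂ ha₃, F.leviCivita_comb hx hY hb₁ hb₂ hb₃,
    F.leviCivita_comb_left hx hZ hc₁ hc₂ hc₃]

theorem curvature_u_v (F : NullFrame P g U) (h : P.IsParaSasakian g) (hx : x ∈ U) :
    g.curvature F.u F.v F.u x = (3 - F.K x) • F.u x ∧
    g.curvature F.u F.v F.v x = (F.K x - 3) • F.v x ∧
    g.curvature F.u F.v P.ξ x = 0 := by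
  have su := F.smooth_u x hx
  have sv := F.smooth_v x hx
  have sξ := P.contMDiff_ξ x
  have sp := F.smooth_p x hx
  have sq := F.smooth_q x hx
  have s := fun c ↦ smoothFunAt_const (n := 3) c x
  have L := fun y hy ↦ F.leviCivita_frame (x := y) h hy
  have hB : ∀ y ∈ U, VectorField.mlieBracket (𝓡 3) F.u F.v y
      = F.p y • F.u y + F.q y • F.v y + (2 : ℝ) • P.ξ y := fun y hy ↦ by
    rw [F.mlieBracket_u_v h hy]; module
  rw [F.curvature_comb (a₁ := -F.p) (a₂ := fun _ ↦ 0) (a₃ := fun _ ↦ -1) (b₁ := -F.q)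
      (b₂ := fun _ ↦ 0) (b₃ := fun _ ↦ 0) (c₃ := fun _ ↦ 2) hx su sv su
      (fun y hy ↦ by rw [(L y hy).2.1.1, Pi.neg_apply]; module)
      (fun y hy ↦ by rw [(L y hy).1.1, Pi.neg_apply]; module)
      hB sp.neg (s _) (s _) sq.neg (s _) (s _) sp sq (s _),
    F.curvature_comb (a₁ := fun _ ↦ 0) (a₂ := F.p) (a₃ := fun _ ↦ 0) (b₁ := fun _ ↦ 0)
      (b₂ := F.q) (b₃ := fun _ ↦ 1) (c₃ := fun _ ↦ 2) hx su sv sv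
      (fun y hy ↦ by rw [(L y hy).2.1.2.1]; module)
      (fun y hy ↦ by rw [(L y hy).1.2.1]; module)
      hB (s _) sp (s _) (s _) sq (s _) sp sq (s _),
    F.curvature_comb (a₁ := fun _ ↦ 0) (a₂ := fun _ ↦ 1) (a₃ := fun _ ↦ 0) (b₁ := fun _ ↦ -1)
      (b₂ := fun _ ↦ 0) (b₃ := fun _ ↦ 0) (c₃ := fun _ ↦ 2) hx su sv sξ
      (fun y hy ↦ by rw [(L y hy).2.1.2.2]; module)
      (fun y hy ↦ by rw [(L y hy).1.2.2]; module)
      hB (s _) (s _) (s _) (s _) (s _) (s _) sp sq (s _)]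
  obtain ⟨⟨l1, l2, l3⟩, ⟨l4, l5, l6⟩, l7, l8, l9⟩ := L x hx
  simp only [l1, l2, l3, l4, l5, l6, l7, l8, l9, dirDeriv_neg, dirDeriv_const, Pi.neg_apply, K]
  refine ⟨?_, ?_, ?_⟩ <;> module

theorem curvature_ξ_u (F : NullFrame P g U) (h : P.IsParaSasakian g) (hx : x ∈ U) :
    g.curvature P.ξ F.u F.u x = 0 ∧
    g.curvature P.ξ F.u F.v x = -P.ξ x ∧
    g.curvature P.ξ F.u P.ξ x = F.u x := by
  have su := F.smooth_u x hx
  have sv := F.smooth_v x hx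
  have sξ := P.contMDiff_ξ x
  have sa := F.smooth_a x hx
  have na : MDifferentiableAt (𝓡 3) 𝓘(ℝ, ℝ) (-F.a) x := SmoothFunAt.mdifferentiableAt sa.neg
  have sq := F.smooth_q x hx
  have s := fun c ↦ smoothFunAt_const (n := 3) c x
  have L := fun y hy ↦ F.leviCivita_frame (x := y) h hy
  have hB : ∀ y ∈ U, VectorField.mlieBracket (𝓡 3) P.ξ F.u y
      = F.a y • F.u y + (0 : ℝ) • F.v y + (0 : ℝ) • P.ξ y := fun y hy ↦ by
    rw [F.mlieBracket_ξ_u h hy]; module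
  rw [F.curvature_comb (a₁ := -F.q) (a₂ := fun _ ↦ 0) (a₃ := fun _ ↦ 0)
      (b₁ := F.a + fun _ ↦ -1) (b₂ := fun _ ↦ 0) (b₃ := fun _ ↦ 0) (c₂ := fun _ ↦ 0)
      (c₃ := fun _ ↦ 0) hx sξ su su
      (fun y hy ↦ by rw [(L y hy).1.1, Pi.neg_apply]; module)
      (fun y hy ↦ by rw [(L y hy).2.2.1, Pi.add_apply]; module)
      hB sq.neg (s _) (s _) (sa.add (s _)) (s _) (s _) sa (s _) (s _),
    F.curvature_comb (a₁ := fun _ ↦ 0) (a₂ := F.q) (a₃ := fun _ ↦ 1) (b₁ := fun _ ↦ 0)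
      (b₂ := -F.a + fun _ ↦ 1) (b₃ := fun _ ↦ 0) (c₂ := fun _ ↦ 0) (c₃ := fun _ ↦ 0) hx sξ su sv
      (fun y hy ↦ by rw [(L y hy).1.2.1]; module)
      (fun y hy ↦ by rw [(L y hy).2.2.2.1, Pi.add_apply, Pi.neg_apply]; module)
      hB (s _) sq (s _) (s _) (sa.neg.add (s _)) (s _) sa (s _) (s _),
    F.curvature_comb (a₁ := fun _ ↦ -1) (a₂ := fun _ ↦ 0) (a₃ := fun _ ↦ 0) (b₁ := fun _ ↦ 0)
      (b₂ := fun _ ↦ 0) (b₃ := fun _ ↦ 0) (c₂ := fun _ ↦ 0) (c₃ := fun _ ↦ 0) hx sξ su sξ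
      (fun y hy ↦ by rw [(L y hy).1.2.2]; module)
      (fun y hy ↦ by rw [(L y hy).2.2.2.2]; module)
      hB (s _) (s _) (s _) (s _) (s _) (s _) sa (s _) (s _)]
  obtain ⟨⟨l1, l2, l3⟩, ⟨l4, l5, l6⟩, l7, l8, l9⟩ := L x hx
  have J : dirDeriv P.ξ F.q x = F.q x * F.a x - dirDeriv F.u F.a x := by
    linarith [F.jacobi_v h hx]
  simp only [l1, l2, l3, l4, l5, l6, l7, l8, l9, dirDeriv_neg, dirDeriv_const, Pi.neg_apply,
    Pi.add_apply, dirDeriv_add sa.mdifferentiableAt (s _).mdifferentiableAt,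
    dirDeriv_add na (s _).mdifferentiableAt, J]
  refine ⟨?_, ?_, ?_⟩ <;> module

theorem curvature_ξ_v (F : NullFrame P g U) (h : P.IsParaSasakian g) (hx : x ∈ U) :
    g.curvature P.ξ F.v F.u x = -P.ξ x ∧
    g.curvature P.ξ F.v F.v x = 0 ∧
    g.curvature P.ξ F.v P.ξ x = F.v x := by
  have su := F.smooth_u x hx
  have sv := F.smooth_v x hx
  have sξ := P.contMDiff_ξ x
  have sa := F.smooth_a x hx
  have na : MDifferentiableAt (𝓡 3) 𝓘(ℝ, ℝ) (-F.a) x := SmoothFunAt.mdifferentiableAt sa.neg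
  have sp := F.smooth_p x hx
  have s := fun c ↦ smoothFunAt_const (n := 3) c x
  have L := fun y hy ↦ F.leviCivita_frame (x := y) h hy
  have hB : ∀ y ∈ U, VectorField.mlieBracket (𝓡 3) P.ξ F.v y
      = (0 : ℝ) • F.u y + (-F.a) y • F.v y + (0 : ℝ) • P.ξ y := fun y hy ↦ by
    rw [F.mlieBracket_ξ_v h hy, Pi.neg_apply]; module
  rw [F.curvature_comb (a₁ := -F.p) (a₂ := fun _ ↦ 0) (a₃ := fun _ ↦ -1)
      (b₁ := F.a + fun _ ↦ -1) (b₂ := fun _ ↦ 0) (b₃ := fun _ ↦ 0) (c₁ := fun _ ↦ 0)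
      (c₃ := fun _ ↦ 0) hx sξ sv su
      (fun y hy ↦ by rw [(L y hy).2.1.1, Pi.neg_apply]; module)
      (fun y hy ↦ by rw [(L y hy).2.2.1, Pi.add_apply]; module)
      hB sp.neg (s _) (s _) (sa.add (s _)) (s _) (s _) (s _) sa.neg (s _),
    F.curvature_comb (a₁ := fun _ ↦ 0) (a₂ := F.p) (a₃ := fun _ ↦ 0) (b₁ := fun _ ↦ 0)
      (b₂ := -F.a + fun _ ↦ 1) (b₃ := fun _ ↦ 0) (c₁ := fun _ ↦ 0) (c₃ := fun _ ↦ 0) hx sξ sv sv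
      (fun y hy ↦ by rw [(L y hy).2.1.2.1]; module)
      (fun y hy ↦ by rw [(L y hy).2.2.2.1, Pi.add_apply, Pi.neg_apply]; module)
      hB (s _) sp (s _) (s _) (sa.neg.add (s _)) (s _) (s _) sa.neg (s _),
    F.curvature_comb (a₁ := fun _ ↦ 0) (a₂ := fun _ ↦ 1) (a₃ := fun _ ↦ 0) (b₁ := fun _ ↦ 0)
      (b₂ := fun _ ↦ 0) (b₃ := fun _ ↦ 0) (c₁ := fun _ ↦ 0) (c₃ := fun _ ↦ 0) hx sξ sv sξ
      (fun y hy ↦ by rw [(L y hy).2.1.2.2]; module)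
      (fun y hy ↦ by rw [(L y hy).2.2.2.2]; module)
      hB (s _) (s _) (s _) (s _) (s _) (s _) (s _) sa.neg (s _)]
  obtain ⟨⟨l1, l2, l3⟩, ⟨l4, l5, l6⟩, l7, l8, l9⟩ := L x hx
  have J : dirDeriv P.ξ F.p x = -(F.p x * F.a x) - dirDeriv F.v F.a x := by
    linarith [F.jacobi_u h hx]
  simp only [l1, l2, l3, l4, l5, l6, l7, l8, l9, dirDeriv_neg, dirDeriv_const, Pi.neg_apply,
    Pi.add_apply, dirDeriv_add sa.mdifferentiableAt (s _).mdifferentiableAt,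
    dirDeriv_add na (s _).mdifferentiableAt, J]
  refine ⟨?_, ?_, ?_⟩ <;> module

end NullFrame
end AlmostParacontactStructure

/-! ### The curvature tensor, the Ricci tensor and the scalar curvature -/

namespace AlmostParacontactStructure
namespace NullFrame

variable {M : Type*} [TopologicalSpace M] [ChartedSpace (EuclideanSpace ℝ (Fin 3)) M]
  [IsManifold (𝓡 3) ∞ M] {P : AlmostParacontactStructure 3 M}
  {g : SemiRiemannianMetric 3 M} {U : Set M} {x : M}
  {X Y Z : ∀ x : M, TangentSpace (𝓡 3) x}

/-- Tensoriality of the curvature in the first argument, for the frame components. -/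
theorem curvature_expand_left (F : NullFrame P g U) (h : P.IsCompatible g) (hx : x ∈ U)
    (hX : ∀ y ∈ U, SmoothFieldAt X y) (hY : ∀ y ∈ U, SmoothFieldAt Y y)
    (hZ : ∀ y ∈ U, SmoothFieldAt Z y) :
    g.curvature X Y Z x = g.inner x (X x) (F.v x) • g.curvature F.u Y Z x
      + g.inner x (X x) (F.u x) • g.curvature F.v Y Z x
      + P.η x (X x) • g.curvature P.ξ Y Z x := by
  have su := F.smooth_u
  have sv := F.smooth_v
  have sξ := fun y (_ : y ∈ U) ↦ P.contMDiff_ξ y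
  let c₁ : M → ℝ := fun y ↦ g.inner y (X y) (F.v y)
  let c₂ : M → ℝ := fun y ↦ g.inner y (X y) (F.u y)
  let c₃ : M → ℝ := fun y ↦ P.η y (X y)
  have s₁ : ∀ y ∈ U, SmoothFunAt 3 c₁ y := fun y hy ↦ g.smooth_inner (hX y hy) (sv y hy)
  have s₂ : ∀ y ∈ U, SmoothFunAt 3 c₂ y := fun y hy ↦ g.smooth_inner (hX y hy) (su y hy)
  have s₃ : ∀ y ∈ U, SmoothFunAt 3 c₃ y := fun y hy ↦ P.smooth_η (hX y hy)
  have t₁ := fun y hy ↦ SmoothFieldAt.smul (s₁ y hy) (su y hy)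
  have t₂ := fun y hy ↦ SmoothFieldAt.smul (s₂ y hy) (sv y hy)
  have t₃ := fun y hy ↦ SmoothFieldAt.smul (s₃ y hy) (sξ y hy)
  rw [curvature_congr F hx (X' := c₁ • F.u + c₂ • F.v + c₃ • P.ξ) (Y' := Y) (Z' := Z)
      (fun y hy ↦ F.decomp h hy (X y)) (fun _ _ ↦ rfl) (fun _ _ ↦ rfl),
    F.curvature_add_left h hx (fun y hy ↦ (t₁ y hy).add (t₂ y hy)) t₃ hY hZ,
    F.curvature_add_left h hx t₁ t₂ hY hZ, F.curvature_smul_left h hx s₁ su hY hZ,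
    F.curvature_smul_left h hx s₂ sv hY hZ, F.curvature_smul_left h hx s₃ sξ hY hZ]

/-- Tensoriality of the curvature in the last argument, for the frame components. -/
theorem curvature_expand_right (F : NullFrame P g U) (h : P.IsCompatible g) (hx : x ∈ U)
    (hX : ∀ y ∈ U, SmoothFieldAt X y) (hY : ∀ y ∈ U, SmoothFieldAt Y y)
    (hZ : ∀ y ∈ U, SmoothFieldAt Z y) :
    g.curvature X Y Z x = g.inner x (Z x) (F.v x) • g.curvature X Y F.u x
      + g.inner x (Z x) (F.u x) • g.curvature X Y F.v x
      + P.η x (Z x) • g.curvature X Y P.ξ x := by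
  have su := F.smooth_u
  have sv := F.smooth_v
  have sξ := fun y (_ : y ∈ U) ↦ P.contMDiff_ξ y
  let c₁ : M → ℝ := fun y ↦ g.inner y (Z y) (F.v y)
  let c₂ : M → ℝ := fun y ↦ g.inner y (Z y) (F.u y)
  let c₃ : M → ℝ := fun y ↦ P.η y (Z y)
  have s₁ : ∀ y ∈ U, SmoothFunAt 3 c₁ y := fun y hy ↦ g.smooth_inner (hZ y hy) (sv y hy)
  have s₂ : ∀ y ∈ U, SmoothFunAt 3 c₂ y := fun y hy ↦ g.smooth_inner (hZ y hy) (su y hy)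
  have s₃ : ∀ y ∈ U, SmoothFunAt 3 c₃ y := fun y hy ↦ P.smooth_η (hZ y hy)
  have t₁ := fun y hy ↦ SmoothFieldAt.smul (s₁ y hy) (su y hy)
  have t₂ := fun y hy ↦ SmoothFieldAt.smul (s₂ y hy) (sv y hy)
  have t₃ := fun y hy ↦ SmoothFieldAt.smul (s₃ y hy) (sξ y hy)
  rw [curvature_congr F hx (X' := X) (Y' := Y) (Z' := c₁ • F.u + c₂ • F.v + c₃ • P.ξ)
      (fun _ _ ↦ rfl) (fun _ _ ↦ rfl) (fun y hy ↦ F.decomp h hy (Z y)),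
    F.curvature_add_right h hx hX hY (fun y hy ↦ (t₁ y hy).add (t₂ y hy)) t₃,
    F.curvature_add_right h hx hX hY t₁ t₂, F.curvature_smul_right h hx s₁ hX hY su,
    F.curvature_smul_right h hx s₂ hX hY sv, F.curvature_smul_right h hx s₃ hX hY sξ]

theorem curvature_eq (F : NullFrame P g U) (h : P.IsParaSasakian g) (hx : x ∈ U)
    (hX : ∀ y ∈ U, SmoothFieldAt X y) (hY : ∀ y ∈ U, SmoothFieldAt Y y)
    (hZ : ∀ y ∈ U, SmoothFieldAt Z y) :
    g.curvature X Y Z x =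
      ((g.inner x (X x) (F.v x) * g.inner x (Y x) (F.u x)
        - g.inner x (X x) (F.u x) * g.inner x (Y x) (F.v x)) * (3 - F.K x))
        • (g.inner x (Z x) (F.v x) • F.u x - g.inner x (Z x) (F.u x) • F.v x)
      + (P.η x (X x) * g.inner x (Y x) (F.v x) - g.inner x (X x) (F.v x) * P.η x (Y x))
        • (P.η x (Z x) • F.u x - g.inner x (Z x) (F.u x) • P.ξ x)
      + (P.η x (X x) * g.inner x (Y x) (F.u x) - g.inner x (X x) (F.u x) * P.η x (Y x))
        • (P.η x (Z x) • F.v x - g.inner x (Z x) (F.v x) • P.ξ x) := by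
  have c := h.1.1
  have su := F.smooth_u
  have sv := F.smooth_v
  have sξ := fun y (_ : y ∈ U) ↦ P.contMDiff_ξ y
  have e : ∀ {X : ∀ x : M, TangentSpace (𝓡 3) x}, (∀ y ∈ U, SmoothFieldAt X y) →
      g.curvature X Y Z x = g.inner x (Y x) (F.v x) • -g.curvature F.u X Z x
      + g.inner x (Y x) (F.u x) • -g.curvature F.v X Z x
      + P.η x (Y x) • -g.curvature P.ξ X Z x := fun {X} hX ↦ by
    rw [g.curvature_swap (hX x hx) (hY x hx) (hZ x hx), F.curvature_expand_left c hx hY hX hZ]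
    module
  have k1 := F.curvature_expand_right c hx su sv hZ
  have k2 := F.curvature_expand_right c hx sξ su hZ
  have k3 := F.curvature_expand_right c hx sξ sv hZ
  obtain ⟨r1, r2, r3⟩ := F.curvature_u_v h hx
  obtain ⟨r4, r5, r6⟩ := F.curvature_ξ_u h hx
  obtain ⟨r7, r8, r9⟩ := F.curvature_ξ_v h hx
  rw [r1, r2, r3] at k1
  rw [r4, r5, r6] at k2
  rw [r7, r8, r9] at k3
  rw [F.curvature_expand_left c hx hX hY hZ, e su, e sv, e sξ,
    g.curvature_self (su x hx) (hZ x hx), g.curvature_self (sv x hx) (hZ x hx),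
    g.curvature_self (sξ x hx) (hZ x hx), g.curvature_swap (sv x hx) (su x hx) (hZ x hx),
    g.curvature_swap (su x hx) (sξ x hx) (hZ x hx), g.curvature_swap (sv x hx) (sξ x hx) (hZ x hx),
    k1, k2, k3]
  module

/-- The curvature tensor of a three-dimensional para-Sasakian metric in a null frame. -/
theorem curvatureAt_eq (F : NullFrame P g U) (h : P.IsParaSasakian g) (hx : x ∈ U)
    (r s t : TangentSpace (𝓡 3) x) :
    g.curvatureAt x r s t =
      ((g.inner x r (F.v x) * g.inner x s (F.u x)
        - g.inner x r (F.u x) * g.inner x s (F.v x)) * (3 - F.K x))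
        • (g.inner x t (F.v x) • F.u x - g.inner x t (F.u x) • F.v x)
      + (P.η x r * g.inner x s (F.v x) - g.inner x r (F.v x) * P.η x s)
        • (P.η x t • F.u x - g.inner x t (F.u x) • P.ξ x)
      + (P.η x r * g.inner x s (F.u x) - g.inner x r (F.u x) * P.η x s)
        • (P.η x t • F.v x - g.inner x t (F.v x) • P.ξ x) := by
  -- on a smaller open set the extensions of the three vectors are smooth fields
  obtain ⟨N, hN, hNo, hxN⟩ := eventually_nhds_iff.1 ((eventually_smoothFieldAt_extend r).and
    ((eventually_smoothFieldAt_extend s).and (eventually_smoothFieldAt_extend t)))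
  have := (F.restrict (F.isOpen.inter hNo) Set.inter_subset_left).curvature_eq h ⟨hx, hxN⟩
    (fun y hy ↦ (hN y hy.2).1) (fun y hy ↦ (hN y hy.2).2.1) (fun y hy ↦ (hN y hy.2).2.2)
  simp only [FiberBundle.extend_apply_self] at this
  exact this

theorem ricci_eq (F : NullFrame P g U) (h : P.IsParaSasakian g) (hx : x ∈ U)
    (s t : TangentSpace (𝓡 3) x) :
    g.ricci x s t = (2 - F.K x) * g.inner x s t + (F.K x - 4) * (P.η x s * P.η x t) := by
  have c := h.1.1
  -- the endomorphism `r ↦ R(r, s) t` as a sum of three endomorphisms of rank one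
  let l₁ : TangentSpace (𝓡 3) x →ₗ[ℝ] ℝ := (g.inner x (F.v x)).toLinearMap
  let l₂ : TangentSpace (𝓡 3) x →ₗ[ℝ] ℝ := (g.inner x (F.u x)).toLinearMap
  let l₃ : TangentSpace (𝓡 3) x →ₗ[ℝ] ℝ := (P.η x).toLinearMap
  let w₁ := g.inner x t (F.v x) • F.u x - g.inner x t (F.u x) • F.v x
  let w₂ := P.η x t • F.u x - g.inner x t (F.u x) • P.ξ x
  let w₃ := P.η x t • F.v x - g.inner x t (F.v x) • P.ξ x
  let T : TangentSpace (𝓡 3) x →ₗ[ℝ] TangentSpace (𝓡 3) x :=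
    l₁.smulRight ((g.inner x s (F.u x) * (3 - F.K x)) • w₁ - P.η x s • w₂)
    + l₂.smulRight (-(g.inner x s (F.v x) * (3 - F.K x)) • w₁ - P.η x s • w₃)
    + l₃.smulRight (g.inner x s (F.v x) • w₂ + g.inner x s (F.u x) • w₃)
  have hT : (fun r ↦ g.curvatureAt x r s t) = T := by
    ext1 r
    rw [F.curvatureAt_eq h hx, g.symm x r (F.v x), g.symm x r (F.u x)]
    simp only [T, w₁, w₂, w₃, l₁, l₂, l₃, LinearMap.add_apply, LinearMap.smulRight_apply,
      ContinuousLinearMap.coe_coe]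
    module
  have hst : g.inner x s t = g.inner x s (F.v x) * g.inner x t (F.u x)
      + g.inner x s (F.u x) * g.inner x t (F.v x) + P.η x s * P.η x t := by
    conv_lhs => rw [F.decomp c hx t]
    simp only [map_add, map_smul, smul_eq_mul, c.inner_ξ]
    ring
  rw [SemiRiemannianMetric.ricci, hT, diagSum_linear, map_add, map_add, LinearMap.trace_smulRight,
    LinearMap.trace_smulRight, LinearMap.trace_smulRight, hst]
  simp only [w₁, w₂, w₃, l₁, l₂, l₃, ContinuousLinearMap.coe_coe, map_add, map_sub, map_smul,
    smul_eq_mul, F.inner_u_u c hx, F.inner_u_v x hx, F.inner_v_u hx, F.inner_v_v c hx, c.inner_ξ,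
    F.η_u hx, F.η_v hx, P.η_ξ]
  ring

theorem ricciOperator_eq (F : NullFrame P g U) (h : P.IsParaSasakian g) (hx : x ∈ U)
    (s : TangentSpace (𝓡 3) x) :
    g.ricciOperator x s = (2 - F.K x) • s + ((F.K x - 4) * P.η x s) • P.ξ x := by
  refine sub_eq_zero.1 (g.nondegenerate x _ fun t ↦ ?_)
  let α : TangentSpace (𝓡 3) x →ₗ[ℝ] ℝ :=
    (2 - F.K x) • (g.inner x s).toLinearMap + ((F.K x - 4) * P.η x s) • (P.η x).toLinearMap
  have hα : g.ricci x s = α := by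
    ext1 t
    rw [F.ricci_eq h hx]
    simp [α, mul_assoc]
  have := g.inner_sharp x α t
  rw [← hα] at this
  change g.inner x (g.ricciOperator x s) t = _ at this
  rw [map_sub, sub_apply, this, F.ricci_eq h hx, map_add, map_smul, map_smul, add_apply,
    smul_apply, smul_apply, g.symm x (P.ξ x), h.1.1.inner_ξ, smul_eq_mul, smul_eq_mul]
  ring

theorem scalarCurvature_eq (F : NullFrame P g U) (h : P.IsParaSasakian g) (hx : x ∈ U) :
    g.scalarCurvature x = 2 - 2 * F.K x := by
  let T : TangentSpace (𝓡 3) x →ₗ[ℝ] TangentSpace (𝓡 3) x :=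
    (2 - F.K x) • LinearMap.id + (F.K x - 4) • (P.η x).toLinearMap.smulRight (P.ξ x)
  have hT : g.ricciOperator x = T := by
    ext1 s
    rw [F.ricciOperator_eq h hx]
    simp [T, mul_smul]
  have h3 : Module.finrank ℝ (TangentSpace (𝓡 3) x) = 3 :=
    finrank_euclideanSpace_fin (𝕜 := ℝ) (n := 3)
  rw [SemiRiemannianMetric.scalarCurvature, hT, diagSum_linear, map_add, map_smul, map_smul,
    LinearMap.trace_id, LinearMap.trace_smulRight, h3]
  simp [P.η_ξ]
  ring

end NullFrame
end AlmostParacontactStructure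

/-! ### The soliton equation in a null frame -/

section FunctionRing

variable {n : ℕ} {M : Type*} [TopologicalSpace M] [ChartedSpace (EuclideanSpace ℝ (Fin n)) M]

/-- The ring of functions on `U` that extend to functions on `M` smooth at every point of `U`; for
open `U` these are the smooth functions on `U`. The extensions keep `dirDeriv` applicable. -/
def smoothFunctions (n : ℕ) {M : Type*} [TopologicalSpace M]
    [ChartedSpace (EuclideanSpace ℝ (Fin n)) M] (U : Set M) : Subalgebra ℝ (U → ℝ) where
  carrier := {f | ∃ F : M → ℝ, (∀ y ∈ U, SmoothFunAt n F y) ∧ (fun y : U ↦ F y) = f}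
  mul_mem' := by
    rintro _ _ ⟨F, hF, rfl⟩ ⟨G, hG, rfl⟩
    exact ⟨F * G, fun y hy ↦ (hF y hy).mul (hG y hy), rfl⟩
  add_mem' := by
    rintro _ _ ⟨F, hF, rfl⟩ ⟨G, hG, rfl⟩
    exact ⟨F + G, fun y hy ↦ (hF y hy).add (hG y hy), rfl⟩
  algebraMap_mem' c := ⟨fun _ ↦ c, fun y _ ↦ smoothFunAt_const c y, rfl⟩

namespace smoothFunctions

variable {U : Set M}

/-- The restriction to `U` of a function that is smooth at every point of `U`. -/
def of (f : M → ℝ) (hf : ∀ y ∈ U, SmoothFunAt n f y) : smoothFunctions n U :=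
  ⟨fun y ↦ f y, f, hf, rfl⟩

theorem exists_eq_of (f : smoothFunctions n U) : ∃ F hF, f = of F hF := by
  obtain ⟨f, F, hF, rfl⟩ := f
  exact ⟨F, hF, rfl⟩

variable [IsManifold (𝓡 n) ∞ M]

/-- A vector field that is smooth on the open set `U`, as a derivation of the smooth functions on
`U`. -/
def derivation (P : AlmostParacontactStructure n M) (hU : IsOpen U)
    (X : ∀ x : M, TangentSpace (𝓡 n) x) (hX : ∀ y ∈ U, SmoothFieldAt X y) :
    Derivation ℝ (smoothFunctions n U) (smoothFunctions n U) :=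
  -- on an open set the derivative does not depend on the chosen extension
  let D : smoothFunctions n U → smoothFunctions n U := fun f ↦
    of (dirDeriv X f.2.choose) (P.smooth_dirDeriv hU f.2.choose_spec.1 hX)
  have hD : ∀ f hf, D (of f hf) = of (dirDeriv X f) (P.smooth_dirDeriv hU hf hX) := by
    intro f hf
    refine Subtype.ext (funext fun y ↦ dirDeriv_congr ?_)
    filter_upwards [hU.mem_nhds y.2] with z hz
    exact congrFun (of f hf).2.choose_spec.2 ⟨z, hz⟩
  Derivation.mk'
    { toFun := D
      map_add' := fun f f' ↦ by
        obtain ⟨f, hf, rfl⟩ := exists_eq_of f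
        obtain ⟨f', hf', rfl⟩ := exists_eq_of f'
        change D (of (f + f') fun y hy ↦ (hf y hy).add (hf' y hy)) = _
        rw [hD, hD, hD]
        refine Subtype.ext (funext fun y ↦ ?_)
        exact dirDeriv_add (hf y y.2).mdifferentiableAt (hf' y y.2).mdifferentiableAt
      map_smul' := fun c f ↦ by
        obtain ⟨f, hf, rfl⟩ := exists_eq_of f
        change D (of ((fun _ ↦ c) * f) fun y hy ↦ (smoothFunAt_const c y).mul (hf y hy)) = _
        rw [hD, hD]
        refine Subtype.ext (funext fun y ↦ ?_)
        change dirDeriv X ((fun _ ↦ c) * f) y = c * dirDeriv X f y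
        rw [dirDeriv_mul (smoothFunAt_const c _).mdifferentiableAt (hf y y.2).mdifferentiableAt,
          dirDeriv_const, mul_zero, add_zero] }
    (fun f f' ↦ by
      obtain ⟨f, hf, rfl⟩ := exists_eq_of f
      obtain ⟨f', hf', rfl⟩ := exists_eq_of f'
      change D (of (f * f') fun y hy ↦ (hf y hy).mul (hf' y hy))
        = of f hf * D (of f' hf') + of f' hf' * D (of f hf)
      rw [hD, hD, hD]
      refine Subtype.ext (funext fun y ↦ ?_)
      exact dirDeriv_mul (hf y y.2).mdifferentiableAt (hf' y y.2).mdifferentiableAt)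

theorem derivation_of (P : AlmostParacontactStructure n M) (hU : IsOpen U)
    (X : ∀ x : M, TangentSpace (𝓡 n) x) (hX : ∀ y ∈ U, SmoothFieldAt X y)
    (f : M → ℝ) (hf : ∀ y ∈ U, SmoothFunAt n f y) :
    derivation P hU X hX (of f hf) = of (dirDeriv X f) (P.smooth_dirDeriv hU hf hX) := by
  refine Subtype.ext (funext fun y ↦ dirDeriv_congr ?_)
  filter_upwards [hU.mem_nhds y.2] with z hz
  exact congrFun (of f hf).2.choose_spec.2 ⟨z, hz⟩

end smoothFunctions
end FunctionRing

namespace AlmostParacontactStructure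
namespace NullFrame

open smoothFunctions

variable {M : Type*} [TopologicalSpace M] [ChartedSpace (EuclideanSpace ℝ (Fin 3)) M]
  [IsManifold (𝓡 3) ∞ M] {P : AlmostParacontactStructure 3 M}
  {g : SemiRiemannianMetric 3 M} {U : Set M} {x : M}
  {V : ∀ x : M, TangentSpace (𝓡 3) x}

/-- The frame field `u` as a derivation. -/
abbrev Du (F : NullFrame P g U) := derivation P F.isOpen F.u F.smooth_u

/-- The frame field `v` as a derivation. -/
abbrev Dv (F : NullFrame P g U) := derivation P F.isOpen F.v F.smooth_v

/-- The field `ξ` as a derivation of the smooth functions on the domain of the frame. -/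
abbrev Dξ (F : NullFrame P g U) := derivation P F.isOpen P.ξ fun x _ ↦ P.contMDiff_ξ x

theorem frameBrackets (F : NullFrame P g U) (h : P.IsParaSasakian g) :
    FrameBrackets F.Du F.Dv F.Dξ (of F.a F.smooth_a) (of F.p F.smooth_p) (of F.q F.smooth_q) where
  comm_ξ_u f := by
    obtain ⟨f, hf, rfl⟩ := exists_eq_of f
    simp only [derivation_of]
    refine Subtype.ext (funext fun y ↦ ?_)
    refine (P.dirDeriv_mlieBracket F.isOpen hf (fun x _ ↦ P.contMDiff_ξ x) F.smooth_u
      y.2).symm.trans ?_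
    change _ = F.a y * dirDeriv F.u f y
    rw [dirDeriv, F.mlieBracket_ξ_u h y.2, map_smul]
    rfl
  comm_ξ_v f := by
    obtain ⟨f, hf, rfl⟩ := exists_eq_of f
    simp only [derivation_of]
    refine Subtype.ext (funext fun y ↦ ?_)
    refine (P.dirDeriv_mlieBracket F.isOpen hf (fun x _ ↦ P.contMDiff_ξ x) F.smooth_v
      y.2).symm.trans ?_
    change _ = -(F.a y * dirDeriv F.v f y)
    rw [dirDeriv, F.mlieBracket_ξ_v h y.2, map_smul, neg_smul]
    rfl
  comm_u_v f := by
    obtain ⟨f, hf, rfl⟩ := exists_eq_of f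
    simp only [derivation_of]
    refine Subtype.ext (funext fun y ↦ ?_)
    refine (P.dirDeriv_mlieBracket F.isOpen hf F.smooth_u F.smooth_v y.2).symm.trans ?_
    exact dirDeriv_of_eq_add f (F.mlieBracket_u_v h y.2)
  jacobi_u := by
    simp only [derivation_of]
    exact Subtype.ext (funext fun y ↦ F.jacobi_u h y.2)
  jacobi_v := by
    simp only [derivation_of]
    exact Subtype.ext (funext fun y ↦ F.jacobi_v h y.2)

theorem smooth_K (F : NullFrame P g U) : ∀ y ∈ U, SmoothFunAt 3 F.K y := fun y hy ↦
  (((P.smooth_dirDeriv F.isOpen F.smooth_p F.smooth_u y hy).sub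
    (P.smooth_dirDeriv F.isOpen F.smooth_q F.smooth_v y hy)).sub
    (((smoothFunAt_const 2 y).mul (F.smooth_p y hy)).mul (F.smooth_q y hy))).add
    ((smoothFunAt_const 2 y).mul (F.smooth_a y hy))

theorem frameCurvature_eq (F : NullFrame P g U) :
    frameCurvature F.Du F.Dv (of F.a F.smooth_a) (of F.p F.smooth_p) (of F.q F.smooth_q)
      = of F.K F.smooth_K := by
  rw [frameCurvature, derivation_of, derivation_of]
  rfl

/-- The `u`-component of a vector field. -/
def compU (F : NullFrame P g U) (V : ∀ x : M, TangentSpace (𝓡 3) x) : M → ℝ :=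
  fun y ↦ g.inner y (V y) (F.v y)

/-- The `v`-component of a vector field. -/
def compV (F : NullFrame P g U) (V : ∀ x : M, TangentSpace (𝓡 3) x) : M → ℝ :=
  fun y ↦ g.inner y (V y) (F.u y)

/-- The `ξ`-component of a vector field. -/
def compξ (_F : NullFrame P g U) (V : ∀ x : M, TangentSpace (𝓡 3) x) : M → ℝ :=
  fun y ↦ P.η y (V y)

theorem smooth_compU (F : NullFrame P g U) (hV : ∀ y, SmoothFieldAt V y) :
    ∀ y ∈ U, SmoothFunAt 3 (F.compU V) y := fun y hy ↦ g.smooth_inner (hV y) (F.smooth_v y hy)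

theorem smooth_compV (F : NullFrame P g U) (hV : ∀ y, SmoothFieldAt V y) :
    ∀ y ∈ U, SmoothFunAt 3 (F.compV V) y := fun y hy ↦ g.smooth_inner (hV y) (F.smooth_u y hy)

theorem smooth_compξ (F : NullFrame P g U) (hV : ∀ y, SmoothFieldAt V y) :
    ∀ y ∈ U, SmoothFunAt 3 (F.compξ V) y := fun y _ ↦ P.smooth_η (hV y)

theorem mlieBracket_expand (F : NullFrame P g U) (h : P.IsCompatible g)
    (hV : ∀ y, SmoothFieldAt V y) (X : ∀ x : M, TangentSpace (𝓡 3) x) (hx : x ∈ U) :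
    VectorField.mlieBracket (𝓡 3) V X x =
      -dirDeriv X (F.compU V) x • F.u x
        + F.compU V x • VectorField.mlieBracket (𝓡 3) F.u X x
      + (-dirDeriv X (F.compV V) x • F.v x
        + F.compV V x • VectorField.mlieBracket (𝓡 3) F.v X x)
      + (-dirDeriv X (F.compξ V) x • P.ξ x
        + F.compξ V x • VectorField.mlieBracket (𝓡 3) P.ξ X x) := by
  have e : V =ᶠ[𝓝 x] F.compU V • F.u + F.compV V • F.v + F.compξ V • P.ξ :=
    F.eventuallyEq_of_eqOn (fun y hy ↦ F.decomp h hy (V y)) hx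
  have d₁ := (F.smooth_compU hV x hx).mdifferentiableAt
  have d₂ := (F.smooth_compV hV x hx).mdifferentiableAt
  have d₃ := (F.smooth_compξ hV x hx).mdifferentiableAt
  have du := (F.smooth_u x hx).diffFieldAt
  have dv := (F.smooth_v x hx).diffFieldAt
  have dξ := (P.contMDiff_ξ x).diffFieldAt
  rw [mlieBracket_congr e (Filter.EventuallyEq.refl _ X),
    VectorField.mlieBracket_add_left ((du.smul d₁).add (dv.smul d₂)) (dξ.smul d₃),
    VectorField.mlieBracket_add_left (du.smul d₁) (dv.smul d₂), mlieBracket_smul_left' d₁ du,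
    mlieBracket_smul_left' d₂ dv, mlieBracket_smul_left' d₃ dξ]

/-- Half the conformal factor of a Yamabe soliton: the function `σ` with `lam - r = 2 σ`, through
the value `r = 2 - 2 K` of the scalar curvature. -/
def conformalFactor (F : NullFrame P g U) (lam : ℝ) : M → ℝ := fun y ↦ F.K y + (lam - 2) / 2

theorem smooth_conformalFactor (F : NullFrame P g U) (lam : ℝ) :
    ∀ y ∈ U, SmoothFunAt 3 (F.conformalFactor lam) y := fun y hy ↦
  (F.smooth_K y hy).add (smoothFunAt_const _ y)

theorem two_mul_conformalFactor (F : NullFrame P g U) (h : P.IsParaSasakian g) (lam : ℝ)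
    (hx : x ∈ U) : 2 * F.conformalFactor lam x = lam - g.scalarCurvature x := by
  rw [F.scalarCurvature_eq h hx, conformalFactor]
  ring

/-- The soliton equation on two fields with constant product. -/
theorem soliton_inner_mlieBracket (F : NullFrame P g U) {lam : ℝ}
    (hV : g.IsYamabeSoliton V lam) (h : P.IsParaSasakian g)
    {X Y : ∀ x : M, TangentSpace (𝓡 3) x} {c : ℝ}
    (hX : SmoothFieldAt X x) (hY : SmoothFieldAt Y x) (hc : ∀ y ∈ U, g.inner y (X y) (Y y) = c)
    (hx : x ∈ U) :
    g.inner x (VectorField.mlieBracket (𝓡 3) V X x) (Y x)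
      + g.inner x (VectorField.mlieBracket (𝓡 3) V Y x) (X x)
      = -(2 * F.conformalFactor lam x) * c := by
  have := hV.2 x X Y hX hY
  rw [lieDerivTensor, F.dirDeriv_of_eqOn_const V hc hx, ← F.two_mul_conformalFactor h lam hx,
    hc x hx, g.symm x (X x)] at this
  linarith

/-- The soliton equation on the pairs `(ξ, ξ)`, `(u, u)`, `(v, v)`, `(u, v)`, `(ξ, u)`, `(ξ, v)`. -/
theorem soliton_equations (F : NullFrame P g U) {lam : ℝ}
    (hV : g.IsYamabeSoliton V lam) (h : P.IsParaSasakian g) (hx : x ∈ U) :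
    dirDeriv P.ξ (F.compξ V) x = F.conformalFactor lam x ∧
    dirDeriv F.u (F.compV V) x = -(F.q x * F.compV V x) ∧
    dirDeriv F.v (F.compU V) x = F.p x * F.compU V x ∧
    dirDeriv F.u (F.compU V) x + dirDeriv F.v (F.compV V) x =
      F.q x * F.compU V x - F.p x * F.compV V x + 2 * F.conformalFactor lam x ∧
    dirDeriv P.ξ (F.compV V) x
      = F.a x * F.compV V x - 2 * F.compV V x - dirDeriv F.u (F.compξ V) x ∧
    dirDeriv P.ξ (F.compU V) x
      = 2 * F.compU V x - F.a x * F.compU V x - dirDeriv F.v (F.compξ V) x := by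
  have c := h.1.1
  have su := F.smooth_u x hx
  have sv := F.smooth_v x hx
  have sξ := P.contMDiff_ξ x
  have hξξ : ∀ y ∈ U, g.inner y (P.ξ y) (P.ξ y) = 1 := fun y _ ↦ by rw [c.inner_ξ, P.η_ξ]
  have e1 := F.soliton_inner_mlieBracket hV h sξ sξ hξξ hx
  have e2 := F.soliton_inner_mlieBracket hV h su su (fun y hy ↦ F.inner_u_u c hy) hx
  have e3 := F.soliton_inner_mlieBracket hV h sv sv (fun y hy ↦ F.inner_v_v c hy) hx
  have e4 := F.soliton_inner_mlieBracket hV h su sv F.inner_u_v hx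
  have e5 := F.soliton_inner_mlieBracket hV h sξ su (fun y hy ↦ F.inner_ξ_u c hy) hx
  have e6 := F.soliton_inner_mlieBracket hV h sξ sv (fun y hy ↦ F.inner_ξ_v c hy) hx
  simp only [F.mlieBracket_expand c hV.1 _ hx, F.mlieBracket_u_v h hx, F.mlieBracket_v_u h hx,
    F.mlieBracket_ξ_u h hx, F.mlieBracket_u_ξ h hx, F.mlieBracket_ξ_v h hx,
    F.mlieBracket_v_ξ h hx, VectorField.mlieBracket_self, Pi.zero_apply, map_zero, zero_apply,
    map_add, map_smul, map_neg, add_apply, smul_apply, neg_apply, smul_eq_mul, smul_zero,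
    F.inner_u_u c hx, F.inner_u_v x hx, F.inner_v_u hx, F.inner_v_v c hx, F.inner_ξ_u c hx,
    F.inner_ξ_v c hx, c.inner_ξ, F.η_u hx, F.η_v hx, P.η_ξ] at e1 e2 e3 e4 e5 e6
  refine ⟨?_, ?_, ?_, ?_, ?_, ?_⟩ <;> linarith

theorem conformalComponents (F : NullFrame P g U) {lam : ℝ}
    (hV : g.IsYamabeSoliton V lam) (h : P.IsParaSasakian g) :
    ConformalComponents F.Du F.Dv F.Dξ (of F.a F.smooth_a) (of F.p F.smooth_p) (of F.q F.smooth_q)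
      (of _ (F.smooth_compU hV.1)) (of _ (F.smooth_compV hV.1)) (of _ (F.smooth_compξ hV.1))
      (of _ (F.smooth_conformalFactor lam)) := by
  have E := fun y (hy : y ∈ U) ↦ F.soliton_equations hV h hy
  constructor <;> simp only [derivation_of] <;> refine Subtype.ext (funext fun y ↦ ?_)
  exacts [(E y y.2).1, (E y y.2).2.1, (E y y.2).2.2.1, (E y y.2).2.2.2.1, (E y y.2).2.2.2.2.1,
    (E y y.2).2.2.2.2.2]

theorem Dξ_conformalFactor (F : NullFrame P g U) (h : P.IsParaSasakian g) (lam : ℝ) :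
    F.Dξ (of _ (F.smooth_conformalFactor lam)) = 0 := by
  have e : of _ (F.smooth_conformalFactor lam)
      = of F.K F.smooth_K + algebraMap ℝ _ ((lam - 2) / 2) := rfl
  rw [e, map_add, Derivation.map_algebraMap, add_zero, ← F.frameCurvature_eq]
  exact (F.frameBrackets h).ξ_frameCurvature

/-- A Yamabe soliton on a three-dimensional para-Sasakian manifold has `lam = r`. Otherwise
`(K - 2)² σ = 0` makes `K`, hence `σ`, constant near a point with `σ ≠ 0`, which contradicts
`u v σ = q v σ + 2 σ`. -/
theorem conformalFactor_eq_zero (F : NullFrame P g U) {lam : ℝ}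
    (hV : g.IsYamabeSoliton V lam) (h : P.IsParaSasakian g) (hx : x ∈ U) :
    F.conformalFactor lam x = 0 := by
  have hσ := F.Dξ_conformalFactor h lam
  have hb := F.frameBrackets h
  have hc := F.conformalComponents hV h
  have h1 : ∀ y ∈ U, (F.K y - 2) ^ 2 * F.conformalFactor lam y = 0 := by
    have := hc.curvature_sq_mul_σ hb hσ
    rw [F.frameCurvature_eq] at this
    intro y hy
    have h2 : 2 * ((F.K y - 2) ^ 2 * F.conformalFactor lam y) = 0 :=
      congrFun (congrArg Subtype.val this) ⟨y, hy⟩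
    linarith
  have h2 : dirDeriv F.u (dirDeriv F.v (F.conformalFactor lam)) x
      = F.q x * dirDeriv F.v (F.conformalFactor lam) x + 2 * F.conformalFactor lam x := by
    have := hc.u_v_σ hb hσ
    simp only [derivation_of] at this
    exact congrFun (congrArg Subtype.val this) ⟨x, hx⟩
  by_contra hne
  -- where the conformal factor does not vanish, `K` is the constant `2`
  have hev : ∀ᶠ y in 𝓝 x, F.conformalFactor lam y = 2 + (lam - 2) / 2 := by
    filter_upwards [F.isOpen.mem_nhds hx,
      (F.smooth_conformalFactor lam x hx).continuousAt.eventually_ne hne] with y hy hy'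
    have := pow_eq_zero_iff (two_ne_zero) |>.1 ((mul_eq_zero.1 (h1 y hy)).resolve_right hy')
    rw [conformalFactor]
    linarith
  have h3 : dirDeriv F.v (F.conformalFactor lam) =ᶠ[𝓝 x] fun _ ↦ 0 := by
    filter_upwards [hev.eventually_nhds] with y hy
    rw [dirDeriv_congr (f' := fun _ ↦ 2 + (lam - 2) / 2) hy, dirDeriv_const]
  rw [dirDeriv_congr h3, dirDeriv_const, h3.eq_of_nhds] at h2
  exact hne (by linarith)

end NullFrame
end AlmostParacontactStructure

/-! ### Consequences of the vanishing of the conformal factor -/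

namespace AlmostParacontactStructure
namespace NullFrame

open smoothFunctions

variable {M : Type*} [TopologicalSpace M] [ChartedSpace (EuclideanSpace ℝ (Fin 3)) M]
  [IsManifold (𝓡 3) ∞ M] {P : AlmostParacontactStructure 3 M}
  {g : SemiRiemannianMetric 3 M} {U : Set M} {x : M}
  {V : ∀ x : M, TangentSpace (𝓡 3) x} {lam : ℝ}

theorem scalarCurvature_eq_of_soliton (F : NullFrame P g U) (hV : g.IsYamabeSoliton V lam)
    (h : P.IsParaSasakian g) (hx : x ∈ U) : g.scalarCurvature x = lam := by
  have := F.two_mul_conformalFactor h lam hx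
  rw [F.conformalFactor_eq_zero hV h hx] at this
  linarith

/-- For `K = 4`, that is `r = -6`, the curvature tensor has constant curvature `-1`. -/
theorem curvatureAt_eq_of_K_eq_four (F : NullFrame P g U) (h : P.IsParaSasakian g) (hx : x ∈ U)
    (hK : F.K x = 4) (r s t : TangentSpace (𝓡 3) x) :
    g.curvatureAt x r s t = (-1 : ℝ) • (g.inner x s t • r - g.inner x r t • s) := by
  have c := h.1.1
  have e : ∀ w, g.inner x w t = g.inner x w (F.v x) * g.inner x t (F.u x)
      + g.inner x w (F.u x) * g.inner x t (F.v x) + P.η x w * P.η x t := fun w ↦ by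
    conv_lhs => rw [F.decomp c hx t]
    simp only [map_add, map_smul, smul_eq_mul, c.inner_ξ]
    ring
  have hr := F.decomp c hx r
  have hs := F.decomp c hx s
  rw [F.curvatureAt_eq h hx, hK, e, e]
  generalize g.inner x r (F.v x) = r₁, g.inner x r (F.u x) = r₂, P.η x r = r₃ at *
  generalize g.inner x s (F.v x) = s₁, g.inner x s (F.u x) = s₂, P.η x s = s₃ at *
  rw [hr, hs]
  module

/-- If `r ≠ -6`, that is `K ≠ 4`, then `curvature_mul_α` and `curvature_mul_β` with `σ = 0` express
the components of the soliton field through `γ = η(V)`, as `2 α = v γ` and `2 β = -u γ`; this makes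
the field commute with `ξ`. -/
theorem mlieBracket_ξ_eq_zero (F : NullFrame P g U) (hV : g.IsYamabeSoliton V lam)
    (h : P.IsParaSasakian g) (hlam : lam ≠ -6) (hx : x ∈ U) :
    VectorField.mlieBracket (𝓡 3) V P.ξ x = 0 := by
  have hK : F.K x - 4 ≠ 0 := fun e ↦ hlam <| by
    rw [← F.scalarCurvature_eq_of_soliton hV h hx, F.scalarCurvature_eq h hx, sub_eq_zero.1 e]
    norm_num
  have hσ := F.Dξ_conformalFactor h lam
  have hb := F.frameBrackets h
  have hc := F.conformalComponents hV h
  have h0 : ∀ y ∈ U, F.conformalFactor lam y = 0 := fun y hy ↦ F.conformalFactor_eq_zero hV h hy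
  have hα : (F.K x - 4) * (2 * F.compU V x - dirDeriv F.v (F.compξ V) x) = 0 := by
    have := hc.curvature_mul_α hb hσ
    rw [F.frameCurvature_eq, derivation_of, derivation_of] at this
    refine (congrFun (congrArg Subtype.val this) ⟨x, hx⟩).trans ?_
    exact neg_eq_zero.2 (F.dirDeriv_of_eqOn_const F.v h0 hx)
  have hβ : (F.K x - 4) * (2 * F.compV V x + dirDeriv F.u (F.compξ V) x) = 0 := by
    have := hc.curvature_mul_β hb hσ
    rw [F.frameCurvature_eq, derivation_of, derivation_of] at this
    refine (congrFun (congrArg Subtype.val this) ⟨x, hx⟩).trans ?_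
    exact neg_eq_zero.2 (F.dirDeriv_of_eqOn_const F.u h0 hx)
  have hα' := (mul_eq_zero.1 hα).resolve_left hK
  have hβ' := (mul_eq_zero.1 hβ).resolve_left hK
  obtain ⟨e1, -, -, -, e5, e6⟩ := F.soliton_equations hV h hx
  rw [h0 x hx] at e1
  have e5' : dirDeriv P.ξ (F.compV V) x = F.a x * F.compV V x := by linarith
  have e6' : dirDeriv P.ξ (F.compU V) x = -(F.a x * F.compU V x) := by linarith
  rw [F.mlieBracket_expand h.1.1 hV.1 _ hx, F.mlieBracket_u_ξ h hx, F.mlieBracket_v_ξ h hx,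
    VectorField.mlieBracket_self, e1, e5', e6', Pi.zero_apply]
  module

/-- A field whose flow preserves the three lines of the frame, and fixes `ξ`, preserves `φ`. -/
theorem mlieBracket_φ (F : NullFrame P g U) (h : P.IsCompatible g) (hx : x ∈ U)
    {c₁ c₂ : ℝ} (hu : VectorField.mlieBracket (𝓡 3) V F.u x = c₁ • F.u x)
    (hv : VectorField.mlieBracket (𝓡 3) V F.v x = c₂ • F.v x)
    (hξ : VectorField.mlieBracket (𝓡 3) V P.ξ x = 0)
    {Y : ∀ x : M, TangentSpace (𝓡 3) x} (hY : SmoothFieldAt Y x) :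
    VectorField.mlieBracket (𝓡 3) V (fun y ↦ P.φ y (Y y)) x
      = P.φ x (VectorField.mlieBracket (𝓡 3) V Y x) := by
  have su := F.smooth_u x hx
  have sv := F.smooth_v x hx
  have sξ := P.contMDiff_ξ x
  let f₁ : M → ℝ := fun y ↦ g.inner y (Y y) (F.v y)
  let f₂ : M → ℝ := fun y ↦ g.inner y (Y y) (F.u y)
  let f₃ : M → ℝ := fun y ↦ P.η y (Y y)
  have s₁ : SmoothFunAt 3 f₁ x := g.smooth_inner hY sv
  have s₂ : SmoothFunAt 3 f₂ x := g.smooth_inner hY su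
  have s₃ : SmoothFunAt 3 f₃ x := P.smooth_η hY
  have t₁ := (SmoothFieldAt.smul s₁ su).diffFieldAt
  have t₂ := (SmoothFieldAt.smul s₂ sv).diffFieldAt
  have s₂' : SmoothFunAt 3 (-f₂) x := s₂.neg
  have t₂' := (SmoothFieldAt.smul s₂' sv).diffFieldAt
  have t₃ := (SmoothFieldAt.smul s₃ sξ).diffFieldAt
  have e : Y =ᶠ[𝓝 x] f₁ • F.u + f₂ • F.v + f₃ • P.ξ :=
    F.eventuallyEq_of_eqOn (fun y hy ↦ F.decomp h hy (Y y)) hx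
  have e' : (fun y ↦ P.φ y (Y y)) =ᶠ[𝓝 x] f₁ • F.u + (-f₂) • F.v := by
    refine F.eventuallyEq_of_eqOn (fun y hy ↦ ?_) hx
    rw [F.decomp h hy (Y y)]
    simp only [map_add, map_smul, F.φ_u y hy, F.φ_v y hy, P.φ_ξ, smul_zero, add_zero, smul_neg,
      Pi.add_apply, Pi.smul_apply', Pi.neg_apply, neg_smul, f₁, f₂]
    rfl
  rw [mlieBracket_congr (Filter.EventuallyEq.refl _ V) e,
    mlieBracket_congr (Filter.EventuallyEq.refl _ V) e',
    VectorField.mlieBracket_add_right t₁ t₂',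
    VectorField.mlieBracket_add_right (t₁.add t₂) t₃, VectorField.mlieBracket_add_right t₁ t₂,
    mlieBracket_smul_right' s₁.mdifferentiableAt su.diffFieldAt,
    mlieBracket_smul_right' s₂.mdifferentiableAt sv.diffFieldAt,
    mlieBracket_smul_right' s₂'.mdifferentiableAt sv.diffFieldAt,
    mlieBracket_smul_right' s₃.mdifferentiableAt sξ.diffFieldAt, hu, hv, hξ, dirDeriv_neg]
  simp only [map_add, map_smul, F.φ_u x hx, F.φ_v x hx, P.φ_ξ, smul_zero, map_zero,
    Pi.neg_apply]
  module

/-- A soliton field is Killing, so once it commutes with `ξ` its flow preserves `ker η` and the null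
lines in it, which are the eigenspaces of `φ`. -/
theorem mlieBracket_φ_of_soliton (F : NullFrame P g U) (hV : g.IsYamabeSoliton V lam)
    (h : P.IsParaSasakian g) (hξ : VectorField.mlieBracket (𝓡 3) V P.ξ x = 0) (hx : x ∈ U)
    {Y : ∀ x : M, TangentSpace (𝓡 3) x} (hY : SmoothFieldAt Y x) :
    VectorField.mlieBracket (𝓡 3) V (fun y ↦ P.φ y (Y y)) x
      = P.φ x (VectorField.mlieBracket (𝓡 3) V Y x) := by
  have c := h.1.1
  have su := F.smooth_u x hx
  have sv := F.smooth_v x hx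
  have sξ := P.contMDiff_ξ x
  have h0 := F.conformalFactor_eq_zero hV h hx
  have e1 := F.soliton_inner_mlieBracket hV h su su (fun y hy ↦ F.inner_u_u c hy) hx
  have e2 := F.soliton_inner_mlieBracket hV h sv sv (fun y hy ↦ F.inner_v_v c hy) hx
  have e3 := F.soliton_inner_mlieBracket hV h sξ su (fun y hy ↦ F.inner_ξ_u c hy) hx
  have e4 := F.soliton_inner_mlieBracket hV h sξ sv (fun y hy ↦ F.inner_ξ_v c hy) hx
  rw [hξ, map_zero, zero_apply, c.inner_ξ, zero_add, mul_zero] at e3 e4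
  have du := F.decomp c hx (VectorField.mlieBracket (𝓡 3) V F.u x)
  have dv := F.decomp c hx (VectorField.mlieBracket (𝓡 3) V F.v x)
  rw [show g.inner x (VectorField.mlieBracket (𝓡 3) V F.u x) (F.u x) = 0 by linarith, e3,
    zero_smul, zero_smul, add_zero, add_zero] at du
  rw [show g.inner x (VectorField.mlieBracket (𝓡 3) V F.v x) (F.v x) = 0 by linarith, e4,
    zero_smul, zero_smul, zero_add, add_zero] at dv
  exact F.mlieBracket_φ c hx du dv hξ hY

end NullFrame

/-- A Killing field that preserves `ξ` and `φ` preserves `η = g(ξ, ·)` and `Φ = g(·, φ ·)`. -/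
theorem isInfinitesimalAutomorphism_of_isKilling {n : ℕ} {M : Type*} [TopologicalSpace M]
    [ChartedSpace (EuclideanSpace ℝ (Fin n)) M] [IsManifold (𝓡 n) ∞ M]
    {P : AlmostParacontactStructure n M} {g : SemiRiemannianMetric n M}
    {V : ∀ x : M, TangentSpace (𝓡 n) x} (h : P.IsCompatible g) (hV : g.IsKilling V)
    (hξ : ∀ x, VectorField.mlieBracket (𝓡 n) V P.ξ x = 0)
    (hφ : ∀ x (Y : ∀ x : M, TangentSpace (𝓡 n) x), SmoothFieldAt Y x →
      VectorField.mlieBracket (𝓡 n) V (fun y ↦ P.φ y (Y y)) x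
        = P.φ x (VectorField.mlieBracket (𝓡 n) V Y x)) :
    P.IsInfinitesimalAutomorphism g V := by
  refine ⟨fun x X hX ↦ ?_, hξ, fun x X Y hX hY ↦ ?_, hV⟩
  · have := hV x X P.ξ hX (P.contMDiff_ξ x)
    simpa only [lieDerivTensor, lieDerivForm, hξ, map_zero, sub_zero, h.inner_ξ] using this
  · have := hV x X (fun y ↦ P.φ y (Y y)) hX (P.smooth_φ hY)
    rwa [lieDerivTensor, hφ x Y hY] at this

end AlmostParacontactStructure
end

theorem theorem3p5 {M : Type*} [TopologicalSpace M] [T2Space M]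
    [ChartedSpace (EuclideanSpace ℝ (Fin 3)) M] [IsManifold (𝓡 3) ∞ M]
    (P : AlmostParacontactStructure 3 M) (g : SemiRiemannianMetric 3 M)
    (hP : P.IsParaSasakian g)
    (V : ∀ x : M, TangentSpace (𝓡 3) x) (lam : ℝ) (hV : g.IsYamabeSoliton V lam) :
    (∃ c : ℝ, ∀ x : M, g.scalarCurvature x = c) ∧
    (∀ x : M, lam = g.scalarCurvature x) ∧
    g.IsKilling V ∧
    ((∀ x : M, g.scalarCurvature x = -6) → g.IsEinstein ∧ g.HasConstantCurvature (-1)) ∧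
    ((∀ x : M, g.scalarCurvature x = -6) ∨ P.IsInfinitesimalAutomorphism g V) := by
  have hF (x : M) : ∃ U : Set M, x ∈ U ∧ Nonempty (P.NullFrame g U) :=
    hP.1.1.exists_nullFrame x
  have hr (x : M) : g.scalarCurvature x = lam := by
    obtain ⟨U, hx, ⟨F⟩⟩ := hF x
    exact F.scalarCurvature_eq_of_soliton hV hP hx
  have hK : g.IsKilling V := fun x X Y hX hY ↦ by
    rw [hV.2 x X Y hX hY, hr, sub_self, zero_mul]
  refine ⟨⟨lam, hr⟩, fun x ↦ (hr x).symm, hK, fun h6 ↦ ?_, ?_⟩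
  · have hF4 (x : M) : ∃ U : Set M, x ∈ U ∧ ∃ F : P.NullFrame g U, F.K x = 4 := by
      obtain ⟨U, hx, ⟨F⟩⟩ := hF x
      refine ⟨U, hx, F, ?_⟩
      have := F.scalarCurvature_eq hP hx
      rw [h6] at this
      linarith
    refine ⟨⟨-2, fun x s t ↦ ?_⟩, fun x r s t ↦ ?_⟩ <;> obtain ⟨U, hx, F, h4⟩ := hF4 x
    · rw [F.ricci_eq hP hx, h4]
      ring
    · exact F.curvatureAt_eq_of_K_eq_four hP hx h4 r s t
  · by_cases hlam : lam = -6
    · exact .inl fun x ↦ (hr x).trans hlam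
    · have hξ (x : M) : VectorField.mlieBracket (𝓡 3) V P.ξ x = 0 := by
        obtain ⟨U, hx, ⟨F⟩⟩ := hF x
        exact F.mlieBracket_ξ_eq_zero hV hP hlam hx
      refine .inr (AlmostParacontactStructure.isInfinitesimalAutomorphism_of_isKilling hP.1.1 hK hξ
        fun x Y hY ↦ ?_)
      obtain ⟨U, hx, ⟨F⟩⟩ := hF x
      exact F.mlieBracket_φ_of_soliton hV hP (hξ x) hx hY
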